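/- Let $\mathbb D$ be the open unit disc in $\mathbb C$ and write $(x)_n=x(x+1)\cdots(x+n-1)$. For $s>0$ let $A^{(s)}(\mathbb D)$ be the Hilbert space of holomorphic functions on $\mathbb D$ with reproducing kernel $(1-z\bar w)^{-2s}$; the functions $\sqrt{(2s)_n/n!}\,z^n$, $n\ge 0$, form an orthonormal basis of it. Let $m\ge 1$ be an integer, $\lambda>m/2$ a real number, $\lambda_j=\lambda-\frac m2+j$ for $0\le j\le m$, and let $\mu=(\mu_0,\mu_1,\dots,\mu_m)$ with $\mu_0=1$ and $\mu_1,\dots,\mu_m>0$. For $f\in A^{(\lambda_j)}(\mathbb D)$ let $\Gamma_jf:\mathbb D\to\mathbb C^{m+1}$ be the function with components $$(\Gamma_jf)_\ell=\binom{\ell}{j}\frac{1}{(2\lambda_j)_{\ell-j}}f^{(\ell-j)}\quad(j\le\ell\le m),\qquad(\Gamma_jf)_\ell=0\quad(0\le\ell<j).$$ The map $(f_0,\dots,f_m)\mapsto\sum_{j=0}^m\mu_j\Gamma_jf_j$ is injective on $\bigoplus_{j=0}^mA^{(\lambda_j)}(\mathbb D)$; let $\mathbf A^{(\lambda,\mu)}(\mathbb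 D)$ be its image, with the inner product that makes this map unitary, and let $M^{(\lambda,\mu)}$ be the operator $(M^{(\lambda,\mu)}f)(z)=zf(z)$ on $\mathbf A^{(\lambda,\mu)}(\mathbb D)$. Then, for every fixed $m\ge1$, the operators $M^{(\lambda,\mu)}$ are mutually unitarily inequivalent: if $\lambda,\lambda'>m/2$, all $\mu_j,\mu_j'>0$, $\mu_0=\mu_0'=1$, and $M^{(\lambda,\mu)}$ and $M^{(\lambda',\mu')}$ are unitarily equivalent, then $\lambda=\lambda'$ and $\mu=\mu'$. -/

import Mathlib

open Complex
open scoped UnitDisc ENNReal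

noncomputable section

namespace HomogeneousShift

/-! ### Transfer of a Hilbert space structure along an injective linear map -/

section Image

variable {E F : Type*} [NormedAddCommGroup E] [InnerProductSpace ℂ E] [AddCommGroup F] [Module ℂ F]

/-- The image of a Hilbert space `E` under an injective linear map `R` into a vector space `F`,
equipped with the inner product transferred from `E`, that is `⟪R x, R y⟫ = ⟪x, y⟫`. -/
def ImageSpace (R : E →ₗ[ℂ] F) (_hR : Function.Injective R) : Type _ := LinearMap.range R

variable (R : E →ₗ[ℂ] F) (hR : Function.Injective R)

instance : AddCommGroup (ImageSpace R hR) := inferInstanceAs (AddCommGroup (LinearMap.range R))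

instance : Module ℂ (ImageSpace R hR) := inferInstanceAs (Module ℂ (LinearMap.range R))

/-- The inclusion of the image of `R` into the ambient space. -/
def ImageSpace.incl : ImageSpace R hR →ₗ[ℂ] F := (LinearMap.range R).subtype

/-- The linear bijection `R x ↦ x` from the image of `R` onto `E`. -/
def ImageSpace.pull : ImageSpace R hR ≃ₗ[ℂ] E := (LinearEquiv.ofInjective R hR).symm

instance : NormedAddCommGroup (ImageSpace R hR) :=
  NormedAddCommGroup.induced _ E (ImageSpace.pull R hR) (ImageSpace.pull R hR).injective

instance : InnerProductSpace ℂ (ImageSpace R hR) where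
  norm_smul_le c x := by
    change ‖ImageSpace.pull R hR (c • x)‖ ≤ ‖c‖ * ‖ImageSpace.pull R hR x‖
    rw [map_smul, norm_smul]
  inner x y := inner ℂ (ImageSpace.pull R hR x) (ImageSpace.pull R hR y)
  norm_sq_eq_re_inner x := norm_sq_eq_re_inner (𝕜 := ℂ) (ImageSpace.pull R hR x)
  conj_inner_symm x y := inner_conj_symm _ _
  add_left x y z := by rw [map_add, inner_add_left]
  smul_left x y c := by rw [map_smul, inner_smul_left]

/-- The bijection `R x ↦ x` is unitary. -/
def ImageSpace.pullIsometry : ImageSpace R hR ≃ₗᵢ[ℂ] E := ⟨ImageSpace.pull R hR, fun _ => rfl⟩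

instance [CompleteSpace E] : CompleteSpace (ImageSpace R hR) :=
  (ImageSpace.pullIsometry R hR).toIsometryEquiv.completeSpace

end Image

/-! ### The weighted Bergman spaces -/

/-- The Pochhammer symbol `(x)_n = x (x + 1) ⋯ (x + n - 1)`. -/
def poch (x : ℝ) (n : ℕ) : ℝ := (ascPochhammer ℝ n).eval x

/-- The coefficient of the `n`-th member `√((2s)_n / n!) z ^ n` of the orthonormal basis of the
Hilbert space with reproducing kernel `(1 - z w̄) ^ (-2s)`. -/
def basisCoeff (s : ℝ) (n : ℕ) : ℝ := √(poch (2 * s) n / n.factorial)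

lemma poch_pos {x : ℝ} (hx : 0 < x) (n : ℕ) : 0 < poch x n := ascPochhammer_pos n x hx

lemma basisCoeff_pos {s : ℝ} (hs : 0 < s) (n : ℕ) : 0 < basisCoeff s n :=
  Real.sqrt_pos.2 (div_pos (poch_pos (by linarith) n) (by positivity))

lemma basisCoeff_succ {s : ℝ} (hs : 0 < s) (n : ℕ) :
    basisCoeff s (n + 1) = basisCoeff s n * √((2 * s + n) / (n + 1)) := by
  have h := poch_pos (x := 2 * s) (by linarith) n
  rw [basisCoeff, basisCoeff, ← Real.sqrt_mul (by positivity)]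
  congr 1
  rw [poch, ascPochhammer_succ_right]
  simp only [Polynomial.eval_mul, Polynomial.eval_add, Polynomial.eval_X, Polynomial.eval_natCast,
    Nat.factorial_succ, Nat.cast_mul, Nat.cast_add, Nat.cast_one, poch]
  field_simp

lemma summable_basisCoeff {s : ℝ} (hs : 0 < s) {r : ℝ} (hr0 : 0 ≤ r) (hr : r < 1) :
    Summable fun n => basisCoeff s n * r ^ n := by
  rcases hr0.eq_or_lt with rfl | hr0
  · refine summable_of_ne_finset_zero (s := {0}) fun n hn => ?_
    simp [zero_pow (by simpa using hn : n ≠ 0)]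
  have hlim : Filter.Tendsto (fun n : ℕ => √((2 * s + n) / (n + 1)) * r) Filter.atTop
      (nhds (√1 * r)) := by
    refine Filter.Tendsto.mul_const _ ((Real.continuous_sqrt.tendsto _).comp ?_)
    have h := tendsto_add_mul_div_add_mul_atTop_nhds (𝕜 := ℝ) (2 * s) 1 1 one_ne_zero
    simpa [add_comm] using h
  refine summable_of_ratio_test_tendsto_lt_one (l := √1 * r) (by simpa using hr)
    (.of_forall fun n => (mul_pos (basisCoeff_pos hs n) (pow_pos hr0 n)).ne') (hlim.congr fun n => ?_)
  have h1 := basisCoeff_pos hs n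
  rw [Real.norm_of_nonneg (mul_pos (basisCoeff_pos hs _) (pow_pos hr0 _)).le,
    Real.norm_of_nonneg (mul_pos h1 (pow_pos hr0 _)).le, basisCoeff_succ hs]
  field_simp
  ring

/-- The square summable complex sequences. -/
abbrev SqSummable : Type := lp (fun _ : ℕ => ℂ) 2

lemma norm_term_le {s : ℝ} (hs : 0 < s) (a : SqSummable) (z : ℂ) (n : ℕ) :
    ‖a n * basisCoeff s n * z ^ n‖ ≤ ‖a‖ * (basisCoeff s n * ‖z‖ ^ n) := by
  rw [norm_mul, norm_mul, norm_pow, Complex.norm_real, Real.norm_of_nonneg (basisCoeff_pos hs n).le,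
    mul_assoc]
  have := basisCoeff_pos hs n
  gcongr
  exact lp.norm_apply_le_norm two_ne_zero a n

lemma summable_term {s : ℝ} (hs : 0 < s) (a : SqSummable) {z : ℂ} (hz : ‖z‖ < 1) :
    Summable fun n => a n * basisCoeff s n * z ^ n :=
  .of_norm_bounded ((summable_basisCoeff hs (norm_nonneg z) hz).mul_left ‖a‖)
    (norm_term_le hs a z)

/-- The linear map that sends a square summable sequence `a` to the function
`z ↦ ∑ a_n √((2s)_n / n!) z ^ n` on the unit disc. -/
def bergmanSeries (s : ℝ) (hs : 0 < s) : SqSummable →ₗ[ℂ] (𝔻 → ℂ) where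
  toFun a z := ∑' n, a n * basisCoeff s n * (z : ℂ) ^ n
  map_add' a b := by
    funext z
    rw [Pi.add_apply, ← (summable_term hs a z.norm_lt_one).tsum_add
      (summable_term hs b z.norm_lt_one)]
    exact tsum_congr fun n => by simp [add_mul]
  map_smul' c a := by
    funext z
    simp only [RingHom.id_apply, Pi.smul_apply, smul_eq_mul]
    rw [← tsum_mul_left]
    exact tsum_congr fun n => by simp [mul_assoc]

/-- The extension by zero of a function on the unit disc. -/
def extend (f : 𝔻 → ℂ) (w : ℂ) : ℂ := if h : ‖w‖ < 1 then f (UnitDisc.mk w h) else 0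

/-- The `k`-th complex derivative of a function on the unit disc. -/
def discDeriv (k : ℕ) (f : 𝔻 → ℂ) (z : 𝔻) : ℂ := iteratedDeriv k (extend f) z

lemma discDeriv_zero (f : 𝔻 → ℂ) (z : 𝔻) : discDeriv 0 f z = f z := by
  simp [discDeriv, extend, z.norm_lt_one]

lemma hasFPowerSeriesOnBall_bergmanSeries {s : ℝ} (hs : 0 < s) (a : SqSummable) :
    HasFPowerSeriesOnBall (extend (bergmanSeries s hs a))
      (FormalMultilinearSeries.ofScalars ℂ fun n => a n * (basisCoeff s n : ℂ)) 0 1 := by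
  set p := FormalMultilinearSeries.ofScalars ℂ fun n => a n * (basisCoeff s n : ℂ) with hp
  have hrad : 1 ≤ p.radius := by
    refine ENNReal.le_of_forall_nnreal_lt fun r hr => ?_
    refine p.le_radius_of_summable_norm ?_
    have hr1 : (r : ℝ) < 1 := by exact_mod_cast hr
    refine .of_nonneg_of_le (fun n => by positivity) (fun n => ?_)
      ((summable_basisCoeff hs r.coe_nonneg hr1).mul_left ‖a‖)
    have h := norm_term_le hs a (r : ℂ) n
    rw [norm_mul, norm_pow] at h
    simpa [hp, FormalMultilinearSeries.ofScalars_norm] using h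
  refine ((p.hasFPowerSeriesOnBall (zero_lt_one.trans_le hrad)).mono zero_lt_one hrad).congr ?_
  intro w hw
  have hw1 : ‖w‖ < 1 := by
    rw [Metric.mem_eball, edist_zero_right] at hw
    simpa [enorm, ← NNReal.coe_lt_coe] using hw
  simp only [extend, hw1, dif_pos, FormalMultilinearSeries.sum, hp,
    FormalMultilinearSeries.ofScalars_apply_eq, bergmanSeries, LinearMap.coe_mk, AddHom.coe_mk,
    UnitDisc.coe_mk, smul_eq_mul]

lemma analyticAt_bergmanSeries {s : ℝ} (hs : 0 < s) (a : SqSummable) (z : 𝔻) :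
    AnalyticAt ℂ (extend (bergmanSeries s hs a)) z := by
  refine (hasFPowerSeriesOnBall_bergmanSeries hs a).analyticAt_of_mem ?_
  rw [Metric.mem_eball, edist_zero_right]
  simpa [enorm, ← NNReal.coe_lt_coe] using z.norm_lt_one

lemma bergmanSeries_injective {s : ℝ} (hs : 0 < s) : Function.Injective (bergmanSeries s hs) := by
  rw [injective_iff_map_eq_zero]
  intro a ha
  have h := (hasFPowerSeriesOnBall_bergmanSeries hs a).hasFPowerSeriesAt
  have h0 : extend (bergmanSeries s hs a) = 0 := by
    funext w
    simp [extend, ha]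
  rw [h0] at h
  have h1 := h.eq_zero
  ext n
  have h2 := (FormalMultilinearSeries.ofScalars_eq_zero ℂ n).1 (congrFun h1 n)
  have h3 : (basisCoeff s n : ℂ) ≠ 0 := by exact_mod_cast (basisCoeff_pos hs n).ne'
  simpa [h3] using h2

/-- The Hilbert space `A^{(s)}(𝔻)` of holomorphic functions on the unit disc, `s > 0`, with
reproducing kernel `(1 - z w̄) ^ (-2s)`: the functions `√((2s)_n / n!) z ^ n` form an orthonormal
basis of it. -/
abbrev Bergman (s : ℝ) (hs : 0 < s) : Type :=
  ImageSpace (bergmanSeries s hs) (bergmanSeries_injective hs)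

/-- An element of `A^{(s)}(𝔻)` as a function on the unit disc. -/
def Bergman.fn {s : ℝ} {hs : 0 < s} : Bergman s hs →ₗ[ℂ] (𝔻 → ℂ) := ImageSpace.incl _ _

lemma Bergman.fn_injective {s : ℝ} {hs : 0 < s} :
    Function.Injective (Bergman.fn (s := s) (hs := hs)) := Subtype.val_injective

lemma Bergman.analyticAt {s : ℝ} {hs : 0 < s} (f : Bergman s hs) (z : 𝔻) :
    AnalyticAt ℂ (extend (Bergman.fn f)) z := by
  obtain ⟨g, a, rfl⟩ := f
  exact analyticAt_bergmanSeries hs a z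

/-- The `k`-th derivative as a linear map on `A^{(s)}(𝔻)`. -/
def Bergman.derivative {s : ℝ} {hs : 0 < s} (k : ℕ) : Bergman s hs →ₗ[ℂ] (𝔻 → ℂ) where
  toFun f := discDeriv k (Bergman.fn f)
  map_add' f g := by
    funext z
    have h : extend (Bergman.fn (f + g)) = extend (Bergman.fn f) + extend (Bergman.fn g) := by
      funext w
      by_cases hw : ‖w‖ < 1 <;> simp [extend, hw]
    rw [Pi.add_apply, discDeriv, h]
    exact iteratedDeriv_add (f.analyticAt z).contDiffAt (g.analyticAt z).contDiffAt
  map_smul' c f := by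
    funext z
    have h : extend (Bergman.fn (c • f)) = c • extend (Bergman.fn f) := by
      funext w
      by_cases hw : ‖w‖ < 1 <;> simp [extend, hw]
    rw [RingHom.id_apply, Pi.smul_apply, discDeriv, h]
    exact iteratedDeriv_const_smul (f.analyticAt z).contDiffAt c

/-! ### The spaces of vector-valued functions -/

/-- The number `λ_j = λ - m / 2 + j`. -/
def lamIdx {m : ℕ} (lam : ℝ) (j : Fin (m + 1)) : ℝ := lam - m / 2 + (j : ℕ)

lemma lamIdx_pos {m : ℕ} {lam : ℝ} (hlam : (m : ℝ) / 2 < lam) (j : Fin (m + 1)) :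
    0 < lamIdx lam j := by
  have : (0 : ℝ) ≤ ((j : ℕ) : ℝ) := Nat.cast_nonneg _
  unfold lamIdx
  linarith

/-- The operator `Γ_j` from `A^{(λ_j)}(𝔻)` to the `ℂ^{m+1}`-valued functions on the disc:
`(Γ_j f)_ℓ = (ℓ choose j) (1 / (2 λ_j)_{ℓ - j}) f^{(ℓ - j)}` for `ℓ ≥ j`, and `0` for `ℓ < j`. -/
def Gam {m : ℕ} {lam : ℝ} (hlam : (m : ℝ) / 2 < lam) (j : Fin (m + 1)) :
    Bergman (lamIdx lam j) (lamIdx_pos hlam j) →ₗ[ℂ] (𝔻 → Fin (m + 1) → ℂ) :=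
  LinearMap.pi fun z => LinearMap.pi fun l =>
    if j ≤ l then
      (((l : ℕ).choose j : ℂ) * (1 / (poch (2 * lamIdx lam j) ((l : ℕ) - j) : ℂ))) •
        (LinearMap.proj z ∘ₗ Bergman.derivative ((l : ℕ) - j))
    else 0

/-- The orthogonal direct sum of the Hilbert spaces `A^{(λ_j)}(𝔻)`, `0 ≤ j ≤ m`. -/
abbrev BergmanSum {m : ℕ} {lam : ℝ} (hlam : (m : ℝ) / 2 < lam) : Type :=
  PiLp 2 fun j : Fin (m + 1) => Bergman (lamIdx lam j) (lamIdx_pos hlam j)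

/-- The map `Γ = ⊕ μ_j Γ_j`, that is `(f_0, …, f_m) ↦ ∑ μ_j Γ_j f_j`. -/
def GamSum {m : ℕ} {lam : ℝ} (hlam : (m : ℝ) / 2 < lam) (mu : Fin (m + 1) → ℝ) :
    BergmanSum hlam →ₗ[ℂ] (𝔻 → Fin (m + 1) → ℂ) :=
  (∑ j, (mu j : ℂ) • (Gam hlam j ∘ₗ LinearMap.proj j)) ∘ₗ
    (WithLp.linearEquiv 2 ℂ _).toLinearMap

lemma GamSum_injective {m : ℕ} {lam : ℝ} (hlam : (m : ℝ) / 2 < lam) {mu : Fin (m + 1) → ℝ}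
    (hmu : ∀ j, 0 < mu j) : Function.Injective (GamSum hlam mu) := by
  rw [injective_iff_map_eq_zero]
  intro f hf
  have key : ∀ n : ℕ, ∀ j : Fin (m + 1), (j : ℕ) = n → f j = 0 := by
    intro n
    induction n using Nat.strong_induction_on with
    | _ n ih =>
      rintro l rfl
      refine Bergman.fn_injective ?_
      rw [map_zero]
      funext z
      have h := congrFun (congrFun hf z) l
      simp only [GamSum, LinearMap.comp_apply, LinearMap.sum_apply, Finset.sum_apply,
        LinearMap.smul_apply, Pi.smul_apply, LinearMap.proj_apply] at h
      rw [Finset.sum_eq_single l] at h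
      · have hl : (mu l : ℂ) ≠ 0 := by exact_mod_cast (hmu l).ne'
        simpa [Gam, poch, Bergman.derivative, discDeriv_zero, hl] using h
      · intro j _ hj
        rcases lt_or_gt_of_ne hj with hlt | hgt
        · have h0 := ih j hlt j rfl
          have : (WithLp.linearEquiv 2 ℂ _).toLinearMap f j = 0 := h0
          rw [this]
          simp
        · simp [Gam, not_le.2 hgt]
      · simp
  ext j : 1
  exact key j j rfl

/-- The Hilbert space `A^{(λ, μ)}(𝔻)`: the algebraic direct sum of the images of the `Γ_j`, with
the inner product that makes `Γ = ⊕ μ_j Γ_j` unitary, so that the vectors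
`μ_j Γ_j (√((2 λ_j)_n / n!) z ^ n)` form an orthonormal basis. -/
abbrev VecSpace {m : ℕ} {lam : ℝ} (hlam : (m : ℝ) / 2 < lam) {mu : Fin (m + 1) → ℝ}
    (hmu : ∀ j, 0 < mu j) : Type :=
  ImageSpace (GamSum hlam mu) (GamSum_injective hlam hmu)

/-- An element of `A^{(λ, μ)}(𝔻)` as a function on the unit disc. -/
def VecSpace.fn {m : ℕ} {lam : ℝ} {hlam : (m : ℝ) / 2 < lam} {mu : Fin (m + 1) → ℝ}
    {hmu : ∀ j, 0 < mu j} : VecSpace hlam hmu →ₗ[ℂ] (𝔻 → Fin (m + 1) → ℂ) :=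
  ImageSpace.incl _ _

lemma VecSpace.fn_injective {m : ℕ} {lam : ℝ} {hlam : (m : ℝ) / 2 < lam} {mu : Fin (m + 1) → ℝ}
    {hmu : ∀ j, 0 < mu j} : Function.Injective (VecSpace.fn (hlam := hlam) (hmu := hmu)) :=
  Subtype.val_injective

/-- The multiplication operator `M^{(λ, μ)}` on `A^{(λ, μ)}(𝔻)`, `(M f)(z) = z f(z)`, with its
natural domain: all `f` in the space for which `z ↦ z f(z)` is in the space. -/
def mulOp {m : ℕ} {lam : ℝ} (hlam : (m : ℝ) / 2 < lam) {mu : Fin (m + 1) → ℝ}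
    (hmu : ∀ j, 0 < mu j) : VecSpace hlam hmu →ₗ.[ℂ] VecSpace hlam hmu where
  domain :=
    { carrier := {f | ∃ g : VecSpace hlam hmu, ∀ z : 𝔻, VecSpace.fn g z = (z : ℂ) • VecSpace.fn f z}
      add_mem' := by
        rintro f f' ⟨g, hg⟩ ⟨g', hg'⟩
        exact ⟨g + g', fun z => by simp [hg z, hg' z]⟩
      zero_mem' := ⟨0, fun z => by simp⟩
      smul_mem' := by
        rintro c f ⟨g, hg⟩
        exact ⟨c • g, fun z => by simp [hg z, smul_comm c (z : ℂ)]⟩ }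
  toFun :=
    { toFun f := f.2.choose
      map_add' f f' := VecSpace.fn_injective <| funext fun z => by
        have h1 := (f + f').2.choose_spec z
        have h2 := f.2.choose_spec z
        have h3 := f'.2.choose_spec z
        rw [h1, map_add, Pi.add_apply, h2, h3]
        simp
      map_smul' c f := VecSpace.fn_injective <| funext fun z => by
        have h1 := (c • f).2.choose_spec z
        have h2 := f.2.choose_spec z
        rw [h1, RingHom.id_apply, map_smul, Pi.smul_apply, h2]
        simp [smul_comm c (z : ℂ)] }

/-- Unitary equivalence of two operators `S` and `T`: there is a unitary `U` which carries the
domain of `S` onto the domain of `T` and satisfies `U S = T U` there. For everywhere defined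
operators this is the usual relation `U S = T U`. -/
def UnitarilyEquivalent {E F : Type*} [NormedAddCommGroup E] [InnerProductSpace ℂ E]
    [NormedAddCommGroup F] [InnerProductSpace ℂ F] (S : E →ₗ.[ℂ] E) (T : F →ₗ.[ℂ] F) : Prop :=
  ∃ U : E ≃ₗᵢ[ℂ] F, (∀ x, x ∈ S.domain ↔ U x ∈ T.domain) ∧
    ∀ (x : S.domain) (y : T.domain), U x = y → U (S x) = T y

end HomogeneousShift

end

/-!
Let `t_{n,l}` be the vector representing the functional "`n`-th Taylor coefficient at `0` of the
`l`-th component", so that `M* t_{n+1,l} = t_{n,l}` and `M* t_{0,l} = 0`. The vectors `t_{0,l}` are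
orthogonal and span the wandering subspace `ker M*`; put `b_l = ‖t_{0,l}‖²`. Iterating the Cauchy
dual `M (M* M)⁻¹` on an orthonormal basis of the wandering subspace gives vectors whose mutual inner
products are unitary invariants of `M`, up to the choice of the basis. For the basis of normalized
`t_{0,p}`, the `k`-th of the resulting matrices lives on the `k`-th superdiagonal, where its entries
are nonzero multiples of `Δ^{k+1} φ (p)` with
`φ_r = r² + (2λ - m - 1) r - r² b_{r-1} / b_r`, the last term being absent for `r > m`.
Since `Δφ` is not constant on `{0, …, m}`, enough of these entries are nonzero to force a change of
basis which intertwines two such families to be diagonal. Hence `Δφ (p)`, `p ≤ m`, is an invariant,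
and with it `φ_0 = 0, φ_1, …, φ_{m+1}`. The value `φ_{m+1}` determines `λ`, the others determine
successively the ratios `b_{r-1} / b_r`, the `b_r`, and the `μ_r`.
-/

noncomputable section

namespace HomogeneousShift

section Operators

variable {E F : Type*} [NormedAddCommGroup E] [InnerProductSpace ℂ E] [NormedAddCommGroup F]
  [InnerProductSpace ℂ F]

lemma UnitarilyEquivalent.exists_graph_iff {S : E →ₗ.[ℂ] E} {T : F →ₗ.[ℂ] F}
    (h : UnitarilyEquivalent S T) :
    ∃ U : E ≃ₗᵢ[ℂ] F, ∀ a b, (a, b) ∈ S.graph ↔ (U a, U b) ∈ T.graph := by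
  obtain ⟨U, hdom, hU⟩ := h
  refine ⟨U, fun a b => ?_⟩
  simp only [LinearPMap.mem_graph_iff]
  constructor
  · rintro ⟨x, rfl, rfl⟩
    let y : T.domain := ⟨U x, (hdom x).1 x.2⟩
    exact ⟨y, rfl, (hU x y rfl).symm⟩
  · rintro ⟨y, hya, hyb⟩
    have ha : a ∈ S.domain := (hdom a).2 (hya ▸ y.2)
    exact ⟨⟨a, ha⟩, rfl, U.injective ((hU ⟨a, ha⟩ y hya.symm).trans hyb)⟩

/-- The wandering subspace of an operator: the orthogonal complement of its range. -/
def wanderingSubspace (T : E →ₗ.[ℂ] E) : Submodule ℂ E := (LinearMap.range T.toFun)ᗮ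

lemma mem_wanderingSubspace {T : E →ₗ.[ℂ] E} {y : E} :
    y ∈ wanderingSubspace T ↔ ∀ a b, (a, b) ∈ T.graph → inner ℂ y b = 0 := by
  rw [wanderingSubspace, Submodule.mem_orthogonal']
  constructor
  · intro h a b hab
    obtain ⟨x, _, hx⟩ := T.mem_graph_iff.1 hab
    exact h b ⟨x, hx⟩
  · rintro h _ ⟨x, rfl⟩
    exact h x _ (T.mem_graph x)

/-- `x` is the image of `y` under the Cauchy dual `T (T* T)⁻¹` of the operator `T`. Inverses and
adjoints are avoided: `x` lies in the closure of the range of `T` and `T* x = y`. -/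
structure IsCauchyDual (T : E →ₗ.[ℂ] E) (y x : E) : Prop where
  inner_eq : ∀ a b, (a, b) ∈ T.graph → inner ℂ x b = inner ℂ y a
  mem_orthogonal : x ∈ (wanderingSubspace T)ᗮ

namespace IsCauchyDual

variable {T : E →ₗ.[ℂ] E} {y x x' : E}

lemma unique (h : IsCauchyDual T y x) (h' : IsCauchyDual T y x') : x = x' := by
  have hmem : x - x' ∈ wanderingSubspace T := mem_wanderingSubspace.2 fun a b hab => by
    rw [inner_sub_left, h.inner_eq a b hab, h'.inner_eq a b hab, sub_self]
  have horth : x - x' ∈ (wanderingSubspace T)ᗮ :=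
    Submodule.sub_mem _ h.mem_orthogonal h'.mem_orthogonal
  exact sub_eq_zero.1 (inner_self_eq_zero.1 (horth _ hmem))

lemma smul (h : IsCauchyDual T y x) (c : ℂ) : IsCauchyDual T (c • y) (c • x) where
  inner_eq a b hab := by rw [inner_smul_left, inner_smul_left, h.inner_eq a b hab]
  mem_orthogonal := Submodule.smul_mem _ c h.mem_orthogonal

lemma sum {ι : Type*} {s : Finset ι} {y x : ι → E} (h : ∀ i ∈ s, IsCauchyDual T (y i) (x i)) :
    IsCauchyDual T (∑ i ∈ s, y i) (∑ i ∈ s, x i) where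
  inner_eq a b hab := by
    rw [sum_inner, sum_inner]
    exact Finset.sum_congr rfl fun i hi => (h i hi).inner_eq a b hab
  mem_orthogonal := Submodule.sum_mem _ fun i hi => (h i hi).mem_orthogonal

end IsCauchyDual

section Intertwining

variable {S : E →ₗ.[ℂ] E} {T : F →ₗ.[ℂ] F} {U : E ≃ₗᵢ[ℂ] F}

lemma map_mem_wanderingSubspace_iff (hU : ∀ a b, (a, b) ∈ S.graph ↔ (U a, U b) ∈ T.graph) {y : E} :
    U y ∈ wanderingSubspace T ↔ y ∈ wanderingSubspace S := by
  simp only [mem_wanderingSubspace, U.surjective.forall, ← hU, LinearIsometryEquiv.inner_map_map]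

lemma IsCauchyDual.map (hU : ∀ a b, (a, b) ∈ S.graph ↔ (U a, U b) ∈ T.graph) {y x : E}
    (h : IsCauchyDual S y x) : IsCauchyDual T (U y) (U x) where
  inner_eq := by
    simpa only [U.surjective.forall, ← hU, LinearIsometryEquiv.inner_map_map] using h.inner_eq
  mem_orthogonal := by
    rw [Submodule.mem_orthogonal, U.surjective.forall]
    intro u hu
    rw [LinearIsometryEquiv.inner_map_map]
    exact h.mem_orthogonal u ((map_mem_wanderingSubspace_iff hU).1 hu)

end Intertwining

/-- The vectors `x n i` are the iterates of an orthonormal basis `x 0` of the wandering subspace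
of `T` under the Cauchy dual of `T`. -/
structure IsCauchyDualFrame {ι : Type*} (T : E →ₗ.[ℂ] E) (x : ℕ → ι → E) : Prop where
  orthonormal : Orthonormal ℂ (x 0)
  span_eq : Submodule.span ℂ (Set.range (x 0)) = wanderingSubspace T
  isCauchyDual : ∀ n i, IsCauchyDual T (x n i) (x (n + 1) i)

variable {ι : Type*}

/-- The matrix of inner products of two families of vectors. -/
def crossGram (x y : ι → E) : Matrix ι ι ℂ := Matrix.of fun i j => inner ℂ (x i) (y j)

lemma crossGram_self [DecidableEq ι] {x : ι → E} (hx : Orthonormal ℂ x) : crossGram x x = 1 := by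
  ext i j
  rw [crossGram, Matrix.of_apply, orthonormal_iff_ite.1 hx, Matrix.one_apply]

lemma crossGram_sum_smul [Fintype ι] (x y : ι → E) (V : Matrix ι ι ℂ) :
    crossGram (fun i => ∑ k, V k i • x k) (fun j => ∑ k, V k j • y k) =
      V.conjTranspose * crossGram x y * V := by
  ext i j
  simp only [crossGram, Matrix.of_apply, Matrix.mul_apply, Matrix.conjTranspose_apply, sum_inner,
    inner_sum, inner_smul_left, inner_smul_right, RCLike.star_def]
  exact Finset.sum_congr rfl fun k _ => mul_comm _ _

theorem UnitarilyEquivalent.exists_crossGram_eq [Fintype ι] [DecidableEq ι] {S : E →ₗ.[ℂ] E}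
    {T : F →ₗ.[ℂ] F} (h : UnitarilyEquivalent S T) {x : ℕ → ι → E} {y : ℕ → ι → F}
    (hx : IsCauchyDualFrame S x) (hy : IsCauchyDualFrame T y) :
    ∃ V : Matrix ι ι ℂ, V.conjTranspose * V = 1 ∧
      ∀ k l, V.conjTranspose * crossGram (y k) (y l) * V = crossGram (x k) (x l) := by
  obtain ⟨U, hU⟩ := h.exists_graph_iff
  have hspan : ∀ i, U (x 0 i) ∈ Submodule.span ℂ (Set.range (y 0)) := fun i => by
    rw [hy.span_eq, map_mem_wanderingSubspace_iff hU, ← hx.span_eq]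
    exact Submodule.subset_span ⟨i, rfl⟩
  choose c hc using fun i => Submodule.mem_span_range_iff_exists_fun ℂ |>.1 (hspan i)
  set V : Matrix ι ι ℂ := Matrix.of fun k i => c i k
  have hmap : ∀ n i, U (x n i) = ∑ k, V k i • y n k := by
    intro n
    induction n with
    | zero => exact fun i => (hc i).symm
    | succ n ih =>
      intro i
      refine ((hx.isCauchyDual n i).map hU).unique ?_
      rw [ih i]
      exact IsCauchyDual.sum fun k _ => (hy.isCauchyDual n k).smul _
  have hgram : ∀ k l, V.conjTranspose * crossGram (y k) (y l) * V = crossGram (x k) (x l) := by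
    intro k l
    rw [← crossGram_sum_smul]
    ext i j
    simp only [crossGram, Matrix.of_apply, ← hmap, LinearIsometryEquiv.inner_map_map]
  refine ⟨V, ?_, hgram⟩
  simpa only [crossGram_self hx.orthonormal, crossGram_self hy.orthonormal, mul_one] using hgram 0 0

end Operators

section Matrices

open scoped ComplexOrder

variable {N : ℕ}

/-- The nonzero entries of the matrix lie on the `k`-th superdiagonal `j = i + k`; for negative `k`
this is a subdiagonal. -/
def IsSuperdiagonal {R : Type*} [Zero R] (k : ℤ) (A : Matrix (Fin N) (Fin N) R) : Prop :=
  ∀ i j : Fin N, (j : ℤ) ≠ i + k → A i j = 0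

/-- The `k`-th superdiagonal of a matrix, as a matrix. -/
def superdiagonalPart {R : Type*} [Zero R] (k : ℤ) (A : Matrix (Fin N) (Fin N) R) :
    Matrix (Fin N) (Fin N) R :=
  Matrix.of fun i j => if (j : ℤ) = i + k then A i j else 0

section Semiring

variable {R : Type*} [Semiring R] {k d : ℤ} {A B : Matrix (Fin N) (Fin N) R}

lemma isSuperdiagonal_superdiagonalPart (k : ℤ) (A : Matrix (Fin N) (Fin N) R) :
    IsSuperdiagonal k (superdiagonalPart k A) := fun _ _ h => if_neg h

lemma IsSuperdiagonal.mul (hA : IsSuperdiagonal k A) (hB : IsSuperdiagonal d B) :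
    IsSuperdiagonal (k + d) (A * B) := by
  intro i j hij
  rw [Matrix.mul_apply]
  refine Finset.sum_eq_zero fun r _ => ?_
  by_cases hr : (r : ℤ) = i + k
  · rw [hB r j (by omega), mul_zero]
  · rw [hA i r hr, zero_mul]

lemma IsSuperdiagonal.conjTranspose [StarRing R] (hA : IsSuperdiagonal k A) :
    IsSuperdiagonal (-k) A.conjTranspose := fun i j hij => by
  rw [Matrix.conjTranspose_apply, hA j i (by omega), star_zero]

lemma IsSuperdiagonal.diagonal_eq (hA : IsSuperdiagonal 0 A) :
    Matrix.diagonal (fun i => A i i) = A := by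
  ext i j
  rw [Matrix.diagonal_apply]
  split_ifs with hij
  · rw [hij]
  · exact (hA i j (by omega)).symm

lemma superdiagonalPart_mul (hB : IsSuperdiagonal k B) (d : ℤ) (A : Matrix (Fin N) (Fin N) R) :
    superdiagonalPart (d + k) (A * B) = superdiagonalPart d A * B := by
  ext i j
  simp only [superdiagonalPart, Matrix.of_apply, Matrix.mul_apply]
  split_ifs with hij
  · refine Finset.sum_congr rfl fun r _ => ?_
    split_ifs with hr
    · rfl
    · rw [hB r j (by omega), mul_zero, mul_zero]
  · refine (Finset.sum_eq_zero fun r _ => ?_).symm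
    split_ifs with hr
    · rw [hB r j (by omega), mul_zero]
    · rw [zero_mul]

lemma mul_superdiagonalPart (hA : IsSuperdiagonal k A) (d : ℤ) (B : Matrix (Fin N) (Fin N) R) :
    superdiagonalPart (d + k) (A * B) = A * superdiagonalPart d B := by
  ext i j
  simp only [superdiagonalPart, Matrix.of_apply, Matrix.mul_apply]
  split_ifs with hij
  · refine Finset.sum_congr rfl fun r _ => ?_
    split_ifs with hr
    · rfl
    · rw [hA i r (by omega), zero_mul, zero_mul]
  · refine (Finset.sum_eq_zero fun r _ => ?_).symm
    split_ifs with hr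
    · rw [hA i r (by omega), zero_mul]
    · rw [mul_zero]

lemma superdiagonalPart_mul_eq_mul {V A' : Matrix (Fin N) (Fin N) R} (hA : IsSuperdiagonal k A)
    (hA' : IsSuperdiagonal k A') (h : V * A = A' * V) (d : ℤ) :
    superdiagonalPart d V * A = A' * superdiagonalPart d V := by
  rw [← superdiagonalPart_mul hA, ← mul_superdiagonalPart hA', h]

end Semiring

/-- The graph on the indices whose edges are the nonzero entries of the matrices `G k` is connected,
expressed by the absence of nonconstant functions invariant along edges. -/
def IsConnectedFamily {κ ι : Type*} (G : κ → Matrix ι ι ℂ) : Prop :=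
  ∀ c : ι → ℂ, (∀ k i j, G k i j ≠ 0 → c i = c j) → ∀ i j, c i = c j

variable {κ : Type*} {G G' : κ → Matrix (Fin N) (Fin N) ℂ}

lemma IsConnectedFamily.apply_eq_of_commute (hG : IsConnectedFamily G)
    {X : Matrix (Fin N) (Fin N) ℂ} (hX : IsSuperdiagonal 0 X) (h : ∀ k, X * G k = G k * X)
    (i j : Fin N) : X i i = X j j := by
  refine hG (fun i => X i i) (fun k p q hpq => mul_right_cancel₀ hpq ?_) i j
  have hentry := congrFun (congrFun (h k) p) q
  rwa [← hX.diagonal_eq, Matrix.diagonal_mul, Matrix.mul_diagonal, mul_comm (G k p q)] at hentry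

lemma IsConnectedFamily.eq_zero_of_commute (hG : IsConnectedFamily G) {d : ℤ} (hd : d ≠ 0)
    {D : Matrix (Fin N) (Fin N) ℂ} (hD : IsSuperdiagonal d D)
    (h : ∀ k, D.conjTranspose * D * G k = G k * (D.conjTranspose * D)) : D = 0 := by
  have hdiag : IsSuperdiagonal 0 (D.conjTranspose * D) := by
    simpa only [neg_add_cancel] using hD.conjTranspose.mul hD
  -- `D` has a zero column, so the scalar matrix `D* D` vanishes.
  have hzero (i : Fin N) : ∃ q, ∀ r, D r q = 0 := by
    rcases lt_or_gt_of_ne hd with hneg | hpos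
    · exact ⟨⟨N - 1, Nat.sub_one_lt_of_lt i.isLt⟩, fun r => hD r _ (by simp only; omega)⟩
    · exact ⟨⟨0, i.pos⟩, fun r => hD r _ (by simp only; omega)⟩
  rw [← Matrix.conjTranspose_mul_self_eq_zero]
  ext i j
  by_cases hij : i = j
  · obtain ⟨q, hq⟩ := hzero i
    rw [← hij, hG.apply_eq_of_commute hdiag h i q, Matrix.mul_apply]
    exact Finset.sum_eq_zero fun r _ => by rw [hq r, mul_zero]
  · exact hdiag i j (by omega)

theorem IsConnectedFamily.isSuperdiagonal_zero_of_intertwines (hconn : IsConnectedFamily G)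
    {δ : κ → ℤ} (hG : ∀ k, IsSuperdiagonal (δ k) (G k)) (hG' : ∀ k, IsSuperdiagonal (δ k) (G' k))
    {V : Matrix (Fin N) (Fin N) ℂ} (hV : V.conjTranspose * V = 1)
    (h : ∀ k, V.conjTranspose * G' k * V = G k) : IsSuperdiagonal 0 V := by
  have hV' : V * V.conjTranspose = 1 := mul_eq_one_comm.1 hV
  have hright : ∀ k, V * G k = G' k * V := fun k => by
    rw [← h k, ← Matrix.mul_assoc, ← Matrix.mul_assoc, hV', Matrix.one_mul]
  have hleft : ∀ k, V * (G k).conjTranspose = (G' k).conjTranspose * V := fun k => by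
    rw [← h k]
    simp only [Matrix.conjTranspose_mul, Matrix.conjTranspose_conjTranspose]
    rw [← Matrix.mul_assoc, hV', Matrix.one_mul]
  intro i j hij
  set D := superdiagonalPart ((j : ℤ) - i) V
  have hDright : ∀ k, D * G k = G' k * D := fun k =>
    superdiagonalPart_mul_eq_mul (hG k) (hG' k) (hright k) _
  have hDleft : ∀ k, G k * D.conjTranspose = D.conjTranspose * G' k := fun k => by
    simpa only [Matrix.conjTranspose_mul, Matrix.conjTranspose_conjTranspose] using
      congrArg Matrix.conjTranspose
        (superdiagonalPart_mul_eq_mul (hG k).conjTranspose (hG' k).conjTranspose (hleft k) _)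
  have hD0 : D = 0 :=
    hconn.eq_zero_of_commute (by omega) (isSuperdiagonal_superdiagonalPart _ V) fun k => by
      rw [Matrix.mul_assoc, hDright, ← Matrix.mul_assoc, ← hDleft, Matrix.mul_assoc]
  have hVD : D i j = V i j := if_pos (by omega)
  rw [← hVD, hD0, Matrix.zero_apply]

lemma apply_self_eq_of_intertwines {V A A' : Matrix (Fin N) (Fin N) ℂ} (hV0 : IsSuperdiagonal 0 V)
    (hV : V.conjTranspose * V = 1) (hA : V.conjTranspose * A' * V = A) (i : Fin N) :
    A i i = A' i i := by
  rw [← hV0.diagonal_eq, Matrix.diagonal_conjTranspose] at hA hV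
  have hone : star (V i i) * V i i = 1 := by
    simpa only [Matrix.diagonal_mul_diagonal, Matrix.diagonal_apply_eq, Matrix.one_apply_eq,
      Pi.star_apply] using congrFun (congrFun hV i) i
  rw [← hA, Matrix.mul_diagonal, Matrix.diagonal_mul, Pi.star_apply, mul_right_comm, hone, one_mul]

end Matrices

section Differences

variable {M G α : Type*} [AddCommMonoid M] [AddCommGroup G]

lemma fwdDiff_iter_sub_const (h : M) (c : M → G) (a : G) {k : ℕ} (hk : k ≠ 0) :
    (fwdDiff h)^[k] (fun r => c r - a) = (fwdDiff h)^[k] c := by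
  obtain ⟨k, rfl⟩ := Nat.exists_eq_succ_of_ne_zero hk
  rw [Function.iterate_succ_apply, Function.iterate_succ_apply]
  congr 1
  funext r
  simp only [fwdDiff, sub_sub_sub_cancel_right]

lemma fwdDiff_iter_ne_zero_of_eq_left {c : ℕ → G} {p k : ℕ} (h : ∀ i < k, c (p + i) = c p)
    (hne : c (p + k) ≠ c p) : (fwdDiff 1)^[k] c p ≠ 0 := by
  have hk : k ≠ 0 := by rintro rfl; exact hne rfl
  rw [← fwdDiff_iter_sub_const 1 c (c p) hk, fwdDiff_iter_eq_sum_shift, Finset.sum_range_succ,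
    Finset.sum_eq_zero]
  · simpa [sub_eq_zero] using hne
  · intro i hi
    simp [h i (Finset.mem_range.1 hi)]

lemma fwdDiff_iter_ne_zero_of_eq_right {c : ℕ → G} {p k : ℕ}
    (h : ∀ i < k, c (p + (i + 1)) = c (p + k)) (hne : c p ≠ c (p + k)) :
    (fwdDiff 1)^[k] c p ≠ 0 := by
  have hk : k ≠ 0 := by rintro rfl; exact hne rfl
  rw [← fwdDiff_iter_sub_const 1 c (c (p + k)) hk, fwdDiff_iter_eq_sum_shift,
    Finset.sum_range_succ', Finset.sum_eq_zero]
  · rcases neg_one_pow_eq_or ℤ k with hsign | hsign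
    · simpa [hsign, sub_eq_zero] using hne
    · simpa [hsign, sub_eq_zero] using hne.symm
  · intro i hi
    simp [h i (Finset.mem_range.1 hi)]

variable {c : ℕ → G} {X : ℕ → α} {m : ℕ}

lemma apply_add_eq_of_fwdDiff_iter_ne_zero
    (h : ∀ p k, p + k ≤ m → (fwdDiff 1)^[k] c p ≠ 0 → X p = X (p + k)) {p : ℕ}
    (hX : X p ≠ X (p + 1)) {k : ℕ} (hk : p + k ≤ m) : c (p + k) = c p := by
  induction k using Nat.strong_induction_on with
  | _ k ih =>
    by_contra hne
    have hp : X p = X (p + k) := h p k hk <|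
      fwdDiff_iter_ne_zero_of_eq_left (fun i hi => ih i hi (by omega)) hne
    have hk1 : k ≠ 1 := by rintro rfl; exact hX hp
    obtain ⟨l, rfl⟩ : ∃ l, k = 1 + (l + 1) := ⟨k - 2, by grind⟩
    have hc1 : c (p + 1) = c p := ih 1 (by omega) (by omega)
    have hp1 : X (p + 1) = X (p + 1 + (l + 1)) := h (p + 1) (l + 1) (by omega) <|
      fwdDiff_iter_ne_zero_of_eq_left
        (fun i hi => by rw [add_assoc, ih (1 + i) (by omega) (by omega), hc1])
        (by rwa [add_assoc, hc1])
    exact hX (by rw [hp, hp1, add_assoc])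

lemma apply_eq_of_fwdDiff_iter_ne_zero
    (h : ∀ p k, p + k ≤ m → (fwdDiff 1)^[k] c p ≠ 0 → X p = X (p + k)) {p : ℕ} (hp : p < m)
    (hX : X p ≠ X (p + 1)) {k q : ℕ} (hq : q + k = p + 1) : c q = c (p + 1) := by
  induction k using Nat.strong_induction_on generalizing q with
  | _ k ih =>
    by_contra hne
    have hq1 : X q = X (p + 1) := hq ▸ h q k (by omega) <|
      fwdDiff_iter_ne_zero_of_eq_right
        (fun i hi => by rw [hq]; exact ih (k - (i + 1)) (by omega) (by omega)) (hq ▸ hne)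
    have hk1 : k ≠ 1 := by rintro rfl; exact hX ((congrArg X (by omega)).trans hq1)
    have hk0 : k ≠ 0 := by rintro rfl; exact hne (congrArg c hq)
    obtain ⟨l, rfl⟩ : ∃ l, p = q + (l + 1) := ⟨p - q - 1, by omega⟩
    have hlast : c (q + (l + 1)) = c (q + (l + 1) + 1) := ih 1 (by omega) rfl
    have hq0 : X q = X (q + (l + 1)) := h q (l + 1) (by omega) <|
      fwdDiff_iter_ne_zero_of_eq_right
        (fun i hi => by rw [hlast]; exact ih (k - (i + 1)) (by omega) (by omega)) (hlast ▸ hne)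
    exact hX (hq0.symm.trans hq1)

theorem eq_of_fwdDiff_iter_ne_zero
    (h : ∀ p k, p + k ≤ m → (fwdDiff 1)^[k] c p ≠ 0 → X p = X (p + k)) (hc : c 0 ≠ c m) {p : ℕ}
    (hp : p ≤ m) : X p = X 0 := by
  induction p with
  | zero => rfl
  | succ p ih =>
    rw [← ih (by omega)]
    by_contra hX
    -- A jump of `X` from `p` to `p + 1` forces `c` to be constant on both sides of the jump.
    have hX' : X p ≠ X (p + 1) := fun he => hX he.symm
    have hright : ∀ k, p + k ≤ m → c (p + k) = c p := fun k =>
      apply_add_eq_of_fwdDiff_iter_ne_zero h hX'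
    refine hc ?_
    rw [apply_eq_of_fwdDiff_iter_ne_zero h hp hX' (zero_add _), hright 1 hp,
      ← hright (m - p) (by omega), Nat.add_sub_cancel' (by omega)]

lemma sum_neg_one_pow_mul_choose {R : Type*} [CommRing R] (f : ℕ → R) (n p : ℕ) :
    ∑ q ∈ Finset.range (n + 1), (-1) ^ q * n.choose q * f (p + q) =
      (-1) ^ n * (fwdDiff 1)^[n] f p := by
  rw [fwdDiff_iter_eq_sum_shift, Finset.mul_sum]
  refine Finset.sum_congr rfl fun q hq => ?_
  obtain ⟨k, rfl⟩ := Nat.exists_eq_add_of_le (Finset.mem_range_succ_iff.1 hq)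
  have hsign : (-1 : R) ^ (q + k) * (-1) ^ k = (-1) ^ q := by
    rw [pow_add, mul_assoc, ← mul_pow, neg_mul_neg, one_mul, one_pow, mul_one]
  rw [Nat.add_sub_cancel_left, zsmul_eq_mul, smul_eq_mul, mul_one, ← hsign]
  push_cast
  ring

end Differences

section TaylorCoefficients

lemma eq_of_hasSum_pow {a b : ℕ → ℂ} {f : 𝔻 → ℂ}
    (ha : ∀ z : 𝔻, HasSum (fun n => a n * (z : ℂ) ^ n) (f z))
    (hb : ∀ z : 𝔻, HasSum (fun n => b n * (z : ℂ) ^ n) (f z)) : a = b := by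
  have hseries : ∀ c : ℕ → ℂ, (∀ z : 𝔻, HasSum (fun n => c n * (z : ℂ) ^ n) (f z)) →
      HasFPowerSeriesAt (extend f) (FormalMultilinearSeries.ofScalars ℂ c) 0 := by
    intro c hc
    rw [hasFPowerSeriesAt_iff]
    filter_upwards [Metric.ball_mem_nhds (0 : ℂ) one_pos] with w hw
    have hw' : ‖w‖ < 1 := mem_ball_zero_iff.1 hw
    simpa [extend, hw', FormalMultilinearSeries.coeff_ofScalars, mul_comm] using
      hc (UnitDisc.mk w hw')
  funext n
  simpa only [FormalMultilinearSeries.coeff_ofScalars] using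
    congrArg (fun p => FormalMultilinearSeries.coeff p n)
      ((hseries a ha).eq_formalMultilinearSeries (hseries b hb))

lemma forall_eq_mul_iff_of_hasSum_pow {a b : ℕ → ℂ} {f g : 𝔻 → ℂ}
    (hf : ∀ z : 𝔻, HasSum (fun n => a n * (z : ℂ) ^ n) (f z))
    (hg : ∀ z : 𝔻, HasSum (fun n => b n * (z : ℂ) ^ n) (g z)) :
    (∀ z : 𝔻, g z = z * f z) ↔ b 0 = 0 ∧ ∀ n, b (n + 1) = a n := by
  set shift : ℕ → ℂ := fun n => Nat.casesOn n 0 a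
  have hshift : ∀ z : 𝔻, HasSum (fun n => shift n * (z : ℂ) ^ n) (z * f z) := by
    intro z
    rw [← hasSum_nat_add_iff' 1, Finset.sum_range_one, show shift 0 = 0 from rfl, zero_mul,
      sub_zero]
    refine ((hf z).mul_left (z : ℂ)).congr_fun fun n => ?_
    rw [show shift (n + 1) = a n from rfl, pow_succ']
    ring
  constructor
  · intro h
    obtain rfl := eq_of_hasSum_pow hg fun z => h z ▸ hshift z
    exact ⟨rfl, fun n => rfl⟩
  · rintro ⟨h0, hsucc⟩ z
    have hb : b = shift := funext fun n => n.casesOn h0 hsucc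
    exact (hg z).unique (hb ▸ hshift z)

lemma iteratedDeriv_extend_bergmanSeries_zero {s : ℝ} (hs : 0 < s) (a : SqSummable) (n : ℕ) :
    iteratedDeriv n (extend (bergmanSeries s hs a)) 0 = n.factorial * (a n * basisCoeff s n) := by
  have h := (hasFPowerSeriesOnBall_bergmanSeries hs a).factorial_smul 1 n
  rw [← iteratedDeriv_eq_iteratedFDeriv] at h
  simp [← h]

lemma hasSum_discDeriv_bergmanSeries {s : ℝ} (hs : 0 < s) (a : SqSummable) (k : ℕ) (z : 𝔻) :
    HasSum (fun n => ((n + k).factorial / n.factorial : ℂ) *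
      (a (n + k) * basisCoeff s (n + k)) * (z : ℂ) ^ n) (discDeriv k (bergmanSeries s hs a) z) := by
  have hdiff : DifferentiableOn ℂ (iteratedDeriv k (extend (bergmanSeries s hs a)))
      (Metric.ball 0 1) := by
    intro w hw
    rw [iteratedDeriv_eq_iterate]
    exact ((analyticAt_bergmanSeries hs a (UnitDisc.mk w (mem_ball_zero_iff.1 hw))).iterated_deriv
      k).differentiableAt.differentiableWithinAt
  have htaylor := Complex.hasSum_taylorSeries_on_ball hdiff (z := z)
    (mem_ball_zero_iff.2 z.norm_lt_one)
  refine htaylor.congr_fun fun n => ?_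
  have hcoeff : iteratedDeriv n (iteratedDeriv k (extend (bergmanSeries s hs a))) 0 =
      (n + k).factorial * (a (n + k) * basisCoeff s (n + k)) := by
    simp only [← iteratedDeriv_extend_bergmanSeries_zero hs a (n + k), iteratedDeriv_eq_iterate,
      Function.iterate_add_apply]
  rw [hcoeff, sub_zero, smul_eq_mul, smul_eq_mul]
  ring

end TaylorCoefficients

section Coordinates

lemma ImageSpace.incl_eq {E F : Type*} [NormedAddCommGroup E] [InnerProductSpace ℂ E]
    [AddCommGroup F] [Module ℂ F] (R : E →ₗ[ℂ] F) (hR : Function.Injective R)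
    (f : ImageSpace R hR) : ImageSpace.incl R hR f = R (ImageSpace.pull R hR f) :=
  (congrArg Subtype.val ((LinearEquiv.ofInjective R hR).apply_symm_apply f)).symm

/-- The `n`-th Taylor coefficient at `0` of the `l`-th component of `Γ_j e`, where `e` is the member
of degree `n + l - j` of the orthonormal basis of `A^{(λ_j)}(𝔻)`. For `l < j` the subtractions are
truncated, but the binomial coefficient vanishes. -/
def taylorCoef {m : ℕ} (lam : ℝ) (n l : ℕ) (j : Fin (m + 1)) : ℝ :=
  l.choose j / poch (2 * lamIdx lam j) (l - j) * ((n + l - j).factorial / n.factorial) *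
    basisCoeff (lamIdx lam j) (n + l - j)

variable {m : ℕ} {lam : ℝ}

lemma taylorCoef_of_lt (lam : ℝ) (n : ℕ) {l : ℕ} {j : Fin (m + 1)} (h : l < j) :
    taylorCoef lam n l j = 0 := by
  simp [taylorCoef, Nat.choose_eq_zero_of_lt h]

lemma taylorCoef_pos (hlam : (m : ℝ) / 2 < lam) (n : ℕ) {l : ℕ} {j : Fin (m + 1)} (h : j ≤ l) :
    0 < taylorCoef lam n l j := by
  have hs := lamIdx_pos hlam j
  have hchoose : (0 : ℝ) < l.choose j := by exact_mod_cast Nat.choose_pos h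
  have hpoch := poch_pos (x := 2 * lamIdx lam j) (by positivity) (l - j)
  have hbasis := basisCoeff_pos hs (n + l - j)
  unfold taylorCoef
  positivity

lemma hasSum_Gam (hlam : (m : ℝ) / 2 < lam) (j : Fin (m + 1))
    (f : Bergman (lamIdx lam j) (lamIdx_pos hlam j)) (l : Fin (m + 1)) (z : 𝔻) :
    HasSum (fun n => (taylorCoef lam n l j : ℂ) * ImageSpace.pullIsometry _ _ f (n + l - j) *
      (z : ℂ) ^ n) (Gam hlam j f z l) := by
  rcases le_or_gt j l with hjl | hlj
  · have hfn : Bergman.fn f = bergmanSeries _ (lamIdx_pos hlam j) (ImageSpace.pullIsometry _ _ f) :=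
      ImageSpace.incl_eq _ _ f
    have hGam : Gam hlam j f z l = ((l : ℕ).choose j : ℂ) *
        (1 / (poch (2 * lamIdx lam j) ((l : ℕ) - j) : ℂ)) *
        discDeriv ((l : ℕ) - j)
          (bergmanSeries _ (lamIdx_pos hlam j) (ImageSpace.pullIsometry _ _ f)) z := by
      rw [← hfn]
      simp only [Gam, LinearMap.pi_apply, if_pos hjl]
      rfl
    rw [hGam]
    refine ((hasSum_discDeriv_bergmanSeries (lamIdx_pos hlam j) _ _ z).mul_left _).congr_fun
      fun n => ?_
    rw [taylorCoef, Nat.add_sub_assoc (show (j : ℕ) ≤ l from hjl)]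
    push_cast
    ring
  · simp [Gam, not_le.2 hlj, taylorCoef_of_lt lam _ (show (l : ℕ) < j from hlj)]

variable (hlam : (m : ℝ) / 2 < lam) {mu : Fin (m + 1) → ℝ} (hmu : ∀ j, 0 < mu j)

/-- The unitary map which sends an element of `A^{(λ, μ)}(𝔻)` to its coordinates with respect to
the orthonormal basis of the vectors `μ_j Γ_j (√((2 λ_j)_d / d!) z ^ d)`. -/
def coordEquiv : VecSpace hlam hmu ≃ₗᵢ[ℂ] PiLp 2 fun _ : Fin (m + 1) => SqSummable :=
  (ImageSpace.pullIsometry _ _).trans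
    (LinearIsometryEquiv.piLpCongrRight 2 fun _ => ImageSpace.pullIsometry _ _)

/-- The vector `μ_j Γ_j (√((2 λ_j)_d / d!) z ^ d)` of the orthonormal basis of `A^{(λ, μ)}(𝔻)`. -/
def basisVec (j : Fin (m + 1)) (d : ℕ) : VecSpace hlam hmu :=
  (coordEquiv hlam hmu).symm (PiLp.single 2 j (lp.single 2 d 1))

lemma inner_basisVec_left (j : Fin (m + 1)) (d : ℕ) (f : VecSpace hlam hmu) :
    inner ℂ (basisVec hlam hmu j d) f = coordEquiv hlam hmu f j d := by
  rw [basisVec, LinearIsometryEquiv.inner_map_eq_flip, LinearIsometryEquiv.symm_symm,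
    PiLp.inner_apply, Finset.sum_eq_single j]
  · simp [lp.inner_single_left]
  · intro i _ hij
    simp [hij]
  · simp

lemma inner_basisVec (j j' : Fin (m + 1)) (d d' : ℕ) :
    inner ℂ (basisVec hlam hmu j d) (basisVec hlam hmu j' d') =
      if j = j' ∧ d = d' then (1 : ℂ) else 0 := by
  rw [inner_basisVec_left, basisVec, LinearIsometryEquiv.apply_symm_apply]
  by_cases hj : j = j'
  · subst hj
    by_cases hd : d = d' <;> simp [hd]
  · simp [hj]

lemma eq_zero_of_inner_basisVec {f : VecSpace hlam hmu}
    (h : ∀ j d, inner ℂ (basisVec hlam hmu j d) f = 0) : f = 0 := by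
  refine (coordEquiv hlam hmu).injective ?_
  rw [map_zero]
  ext j d
  exact (inner_basisVec_left hlam hmu j d f).symm.trans (h j d)

/-- The vector of `A^{(λ, μ)}(𝔻)` which represents the functional "`n`-th Taylor coefficient at `0`
of the `l`-th component". -/
def taylorVec (n l : ℕ) : VecSpace hlam hmu :=
  ∑ j, ((mu j * taylorCoef lam n l j : ℝ) : ℂ) • basisVec hlam hmu j (n + l - j)

lemma inner_taylorVec_left (n l : ℕ) (f : VecSpace hlam hmu) :
    inner ℂ (taylorVec hlam hmu n l) f = ∑ j, ((mu j * taylorCoef lam n l j : ℝ) : ℂ) *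
      inner ℂ (basisVec hlam hmu j (n + l - j)) f := by
  simp only [taylorVec, sum_inner, inner_smul_left, Complex.conj_ofReal]

lemma hasSum_fn (f : VecSpace hlam hmu) (l : Fin (m + 1)) (z : 𝔻) :
    HasSum (fun n => inner ℂ (taylorVec hlam hmu n l) f * (z : ℂ) ^ n) (VecSpace.fn f z l) := by
  set F := ImageSpace.pullIsometry _ _ f
  have hfn : VecSpace.fn f z l = ∑ j, (mu j : ℂ) * Gam hlam j (F j) z l := by
    rw [show VecSpace.fn f = GamSum hlam mu F from ImageSpace.incl_eq _ _ f]
    simp only [GamSum, LinearMap.comp_apply, LinearMap.sum_apply, Finset.sum_apply,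
      LinearMap.smul_apply, Pi.smul_apply, LinearMap.proj_apply, smul_eq_mul]
    rfl
  simp only [hfn, inner_taylorVec_left, Finset.sum_mul]
  refine hasSum_sum fun j _ => ((hasSum_Gam hlam j (F j) l z).mul_left (mu j : ℂ)).congr_fun
    fun n => ?_
  rw [inner_basisVec_left,
    show coordEquiv hlam hmu f j = ImageSpace.pullIsometry _ _ (F j) from rfl]
  push_cast
  ring

lemma mem_graph_mulOp_iff_fn {f g : VecSpace hlam hmu} :
    (f, g) ∈ (mulOp hlam hmu).graph ↔ ∀ z : 𝔻, VecSpace.fn g z = (z : ℂ) • VecSpace.fn f z := by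
  rw [LinearPMap.mem_graph_iff]
  constructor
  · rintro ⟨f, rfl, rfl⟩
    exact f.2.choose_spec
  · intro h
    have hf : f ∈ (mulOp hlam hmu).domain := ⟨g, h⟩
    exact ⟨⟨f, hf⟩, rfl,
      VecSpace.fn_injective (funext fun z => (hf.choose_spec z).trans (h z).symm)⟩

lemma mem_graph_mulOp_iff {f g : VecSpace hlam hmu} :
    (f, g) ∈ (mulOp hlam hmu).graph ↔ ∀ l ≤ m, inner ℂ (taylorVec hlam hmu 0 l) g = 0 ∧
      ∀ n, inner ℂ (taylorVec hlam hmu (n + 1) l) g = inner ℂ (taylorVec hlam hmu n l) f := by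
  have hcomponent : ∀ l : Fin (m + 1), (∀ z : 𝔻, VecSpace.fn g z l = z * VecSpace.fn f z l) ↔ _ :=
    fun l => forall_eq_mul_iff_of_hasSum_pow (hasSum_fn hlam hmu f l) (hasSum_fn hlam hmu g l)
  simp only [mem_graph_mulOp_iff_fn, funext_iff, Pi.smul_apply, smul_eq_mul]
  rw [forall_comm]
  simp only [hcomponent, Fin.forall_iff, Nat.lt_succ_iff]

end Coordinates

section Gram

lemma poch_succ (x : ℝ) (n : ℕ) : poch x (n + 1) = poch x n * (x + n) := by
  simp [poch, ascPochhammer_succ_right]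

lemma basisCoeff_mul_self {s : ℝ} (hs : 0 < s) (n : ℕ) :
    basisCoeff s n * basisCoeff s n = poch (2 * s) n / n.factorial :=
  Real.mul_self_sqrt (div_nonneg (poch_pos (by positivity) n).le (by positivity))

/-- The squared norm of the functional "value at `0` of the `r`-th component" on the image of
`Γ_j`, where `s` stands for `λ_j`. -/
def componentWeight (s : ℝ) (j r : ℕ) : ℝ :=
  r.factorial / j.factorial * (r.choose j / poch (2 * s) (r - j))

lemma componentWeight_of_lt (s : ℝ) {j r : ℕ} (h : r < j) : componentWeight s j r = 0 := by
  simp [componentWeight, Nat.choose_eq_zero_of_lt h]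

lemma componentWeight_self (s : ℝ) (j : ℕ) : componentWeight s j j = 1 := by
  have hj : (j.factorial : ℝ) ≠ 0 := by positivity
  simp [componentWeight, poch, hj]

lemma componentWeight_pos {s : ℝ} (hs : 0 < s) {j r : ℕ} (h : j ≤ r) :
    0 < componentWeight s j r := by
  have hchoose : (0 : ℝ) < r.choose j := by exact_mod_cast Nat.choose_pos h
  have hpoch := poch_pos (x := 2 * s) (by positivity) (r - j)
  unfold componentWeight
  positivity

lemma sq_mul_componentWeight_pred {s : ℝ} (hs : 0 < s) (j r : ℕ) :
    (r : ℝ) ^ 2 * componentWeight s j (r - 1) =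
      (r - j) * (2 * s + r - j - 1) * componentWeight s j r := by
  rcases lt_trichotomy r j with hr | rfl | hr
  · rw [componentWeight_of_lt s hr, componentWeight_of_lt s (by omega), mul_zero, mul_zero]
  · rcases r.eq_zero_or_pos with rfl | hr
    · simp
    · rw [componentWeight_of_lt s (by omega), sub_self, zero_mul, zero_mul, mul_zero]
  · obtain ⟨t, rfl⟩ : ∃ t, r = j + t + 1 := ⟨r - j - 1, by omega⟩
    have hpoch := poch_pos (x := 2 * s) (by positivity) t
    have hchoose : ((j + t).choose j : ℝ) * (j + t + 1) = (j + t + 1).choose j * (t + 1) := by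
      have h := Nat.choose_mul_succ_eq (j + t) j
      rw [show j + t + 1 - j = t + 1 by omega] at h
      exact_mod_cast h
    simp only [componentWeight, Nat.add_sub_cancel, Nat.add_sub_cancel_left,
      show j + t + 1 - j = t + 1 by omega, poch_succ, Nat.factorial_succ]
    push_cast
    field_simp [show 2 * s + t ≠ 0 by positivity]
    linear_combination (2 * s + t) * hchoose

variable {m : ℕ} {lam : ℝ}

lemma taylorCoef_mul_taylorCoef_zero (hlam : (m : ℝ) / 2 < lam) (p n : ℕ)
    (j : Fin (m + 1)) : taylorCoef lam n p j * taylorCoef lam 0 (n + p) j =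
      (n + p).choose p * componentWeight (lamIdx lam j) j p := by
  rcases lt_or_ge p j with hp | hp
  · rw [taylorCoef_of_lt lam n hp, componentWeight_of_lt _ hp, zero_mul, mul_zero]
  have hs := lamIdx_pos hlam j
  have hpoch := poch_pos (x := 2 * lamIdx lam j) (by positivity)
  have hd := hpoch (n + p - j)
  have hpj := hpoch (p - j)
  calc taylorCoef lam n p j * taylorCoef lam 0 (n + p) j
      = p.choose j / poch (2 * lamIdx lam j) (p - j) *
          ((n + p).choose j / poch (2 * lamIdx lam j) (n + p - j)) *
          ((n + p - j).factorial * (n + p - j).factorial / n.factorial) *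
          (basisCoeff (lamIdx lam j) (n + p - j) * basisCoeff (lamIdx lam j) (n + p - j)) := by
        simp only [taylorCoef, zero_add, Nat.factorial_zero, Nat.cast_one]
        ring
    _ = (n + p).choose p * componentWeight (lamIdx lam j) j p := by
        rw [basisCoeff_mul_self hs, componentWeight,
          Nat.cast_choose ℝ (show (j : ℕ) ≤ n + p by omega),
          Nat.cast_choose ℝ (Nat.le_add_left p n), Nat.add_sub_cancel]
        field_simp

lemma taylorCoef_mul_taylorCoef_one_eq_componentWeight (hlam : (m : ℝ) / 2 < lam) {n r l : ℕ}
    (h : n + r = l + 1) (j : Fin (m + 1)) : taylorCoef lam n r j * taylorCoef lam 1 l j =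
      l.factorial / (n.factorial * r.factorial) *
        ((l + 1 - j) * (2 * lamIdx lam j + l - j) * componentWeight (lamIdx lam j) j r) := by
  have hs := lamIdx_pos hlam j
  rcases lt_or_ge r j with hr | hr
  · rw [taylorCoef_of_lt lam n hr, componentWeight_of_lt _ hr, zero_mul, mul_zero, mul_zero]
  rcases lt_or_ge l j with hl | hl
  · have hj : ((j : ℕ) : ℝ) = l + 1 := by exact_mod_cast (show (j : ℕ) = l + 1 by omega)
    rw [taylorCoef_of_lt lam 1 hl, hj, sub_self, mul_zero, zero_mul, zero_mul, mul_zero]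
  obtain ⟨t, rfl⟩ := Nat.exists_eq_add_of_le hl
  have hpoch := poch_pos (x := 2 * lamIdx lam j) (by positivity)
  have ht := hpoch t
  have hrj := hpoch (r - j)
  have hd : n + r - j = t + 1 := by omega
  have hd' : 1 + (j + t) - j = t + 1 := by omega
  calc taylorCoef lam n r j * taylorCoef lam 1 (j + t) j
      = (j + t).choose j / poch (2 * lamIdx lam j) t *
          (r.choose j / poch (2 * lamIdx lam j) (r - j)) *
          ((t + 1).factorial * (t + 1).factorial / n.factorial) *
          (basisCoeff (lamIdx lam j) (t + 1) * basisCoeff (lamIdx lam j) (t + 1)) := by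
        simp only [taylorCoef, hd, hd', Nat.add_sub_cancel_left, Nat.factorial_one, Nat.cast_one]
        ring
    _ = _ := by
        rw [basisCoeff_mul_self hs, componentWeight, poch_succ, Nat.cast_add_choose ℝ,
          Nat.factorial_succ]
        push_cast
        field_simp
        ring

lemma taylorCoef_mul_taylorCoef_one (hlam : (m : ℝ) / 2 < lam) {n r l : ℕ} (h : n + r = l + 1)
    (j : Fin (m + 1)) : taylorCoef lam n r j * taylorCoef lam 1 l j =
      l.factorial / (n.factorial * r.factorial) *
        (n * (2 * lam - m + r + l) * componentWeight (lamIdx lam j) j r +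
          r ^ 2 * componentWeight (lamIdx lam j) j (r - 1)) := by
  have hn : (n : ℝ) = l + 1 - r := by rw [eq_sub_iff_add_eq]; exact_mod_cast h
  have hlam_eq : 2 * lam - m = 2 * lamIdx lam j - 2 * (j : ℕ) := by rw [lamIdx]; ring
  rw [taylorCoef_mul_taylorCoef_one_eq_componentWeight hlam h,
    sq_mul_componentWeight_pred (lamIdx_pos hlam j), hlam_eq, hn]
  ring

/-- The squared norm of the functional "value at `0` of the `r`-th component" on
`A^{(λ, μ)}(𝔻)`. -/
def componentNormSq (lam : ℝ) (mu : Fin (m + 1) → ℝ) (r : ℕ) : ℝ :=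
  ∑ j, mu j ^ 2 * componentWeight (lamIdx lam j) j r

lemma componentNormSq_pos (hlam : (m : ℝ) / 2 < lam) {mu : Fin (m + 1) → ℝ} (hmu : mu 0 ≠ 0)
    (r : ℕ) : 0 < componentNormSq lam mu r := by
  have hnonneg : ∀ j : Fin (m + 1), 0 ≤ mu j ^ 2 * componentWeight (lamIdx lam j) j r := fun j => by
    refine mul_nonneg (sq_nonneg _) ?_
    rcases lt_or_ge r j with hr | hr
    · exact (componentWeight_of_lt _ hr).ge
    · exact (componentWeight_pos (lamIdx_pos hlam j) hr).le
  refine Finset.sum_pos' (fun j _ => hnonneg j) ⟨0, Finset.mem_univ 0, ?_⟩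
  exact mul_pos (by positivity) (componentWeight_pos (lamIdx_pos hlam 0) r.zero_le)

variable (hlam : (m : ℝ) / 2 < lam) {mu : Fin (m + 1) → ℝ} (hmu : ∀ j, 0 < mu j)

lemma inner_basisVec_taylorVec (j : Fin (m + 1)) (d n l : ℕ) :
    inner ℂ (basisVec hlam hmu j d) (taylorVec hlam hmu n l) =
      if d = n + l - j then ((mu j * taylorCoef lam n l j : ℝ) : ℂ) else 0 := by
  rw [taylorVec, inner_sum, Finset.sum_eq_single j]
  · simp [inner_smul_right, inner_basisVec]
  · intro i _ hij
    simp [inner_smul_right, inner_basisVec, hij.symm]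
  · simp

lemma inner_taylorVec_taylorVec_of_ne {n l n' l' : ℕ} (h : n + l ≠ n' + l') :
    inner ℂ (taylorVec hlam hmu n l) (taylorVec hlam hmu n' l') = 0 := by
  rw [inner_taylorVec_left]
  refine Finset.sum_eq_zero fun j _ => ?_
  rw [inner_basisVec_taylorVec]
  rcases lt_or_ge l j with hl | hl
  · simp [taylorCoef_of_lt lam n hl]
  rcases lt_or_ge l' j with hl' | hl'
  · simp [taylorCoef_of_lt lam n' hl']
  rw [if_neg (by omega), mul_zero]

lemma inner_taylorVec_taylorVec {n l n' l' : ℕ} (h : n + l = n' + l') :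
    inner ℂ (taylorVec hlam hmu n l) (taylorVec hlam hmu n' l') =
      ((∑ j, mu j ^ 2 * (taylorCoef lam n l j * taylorCoef lam n' l' j) : ℝ) : ℂ) := by
  rw [inner_taylorVec_left]
  push_cast
  refine Finset.sum_congr rfl fun j _ => ?_
  rw [inner_basisVec_taylorVec, if_pos (by rw [h])]
  push_cast
  ring

lemma inner_taylorVec_taylorVec_zero (p n : ℕ) :
    inner ℂ (taylorVec hlam hmu n p) (taylorVec hlam hmu 0 (n + p)) =
      (((n + p).choose p * componentNormSq lam mu p : ℝ) : ℂ) := by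
  rw [inner_taylorVec_taylorVec hlam hmu (zero_add _).symm, componentNormSq, Finset.mul_sum]
  simp only [taylorCoef_mul_taylorCoef_zero hlam, mul_left_comm]

lemma inner_taylorVec_zero_self (p : ℕ) :
    inner ℂ (taylorVec hlam hmu 0 p) (taylorVec hlam hmu 0 p) =
      (componentNormSq lam mu p : ℂ) := by
  simpa using inner_taylorVec_taylorVec_zero hlam hmu p 0

lemma inner_taylorVec_taylorVec_one {n r l : ℕ} (h : n + r = l + 1) :
    inner ℂ (taylorVec hlam hmu n r) (taylorVec hlam hmu 1 l) =
      ((l.factorial / (n.factorial * r.factorial) *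
        (n * (2 * lam - m + r + l) * componentNormSq lam mu r +
          r ^ 2 * componentNormSq lam mu (r - 1)) : ℝ) : ℂ) := by
  rw [inner_taylorVec_taylorVec hlam hmu (by omega)]
  congr 1
  simp only [taylorCoef_mul_taylorCoef_one hlam h, componentNormSq, Finset.mul_sum,
    ← Finset.sum_add_distrib]
  exact Finset.sum_congr rfl fun j _ => by ring

end Gram

section WanderingSubspace

variable {m : ℕ} {lam : ℝ} {mu : Fin (m + 1) → ℝ}

lemma mulVec_taylorCoef_surjective (hlam : (m : ℝ) / 2 < lam) (hmu : ∀ j, 0 < mu j)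
    (n : ℕ → ℕ) :
    Function.Surjective (Matrix.of fun l j : Fin (m + 1) =>
      ((mu j * taylorCoef lam (n l) l j : ℝ) : ℂ)).mulVec := by
  rw [Matrix.mulVec_surjective_iff_isUnit, Matrix.isUnit_iff_isUnit_det,
    Matrix.det_of_isLowerTriangular _ fun l j hlj => by
      simp [taylorCoef_of_lt lam (n l) (show (l : ℕ) < j from hlj)]]
  refine isUnit_iff_ne_zero.2 (Finset.prod_ne_zero_iff.2 fun j _ => ?_)
  exact Complex.ofReal_ne_zero.2 (mul_pos (hmu j) (taylorCoef_pos hlam _ le_rfl)).ne'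

variable (hlam : (m : ℝ) / 2 < lam) (hmu : ∀ j, 0 < mu j)

lemma exists_inner_taylorVec_eq (d : ℕ) (v : ℕ → ℂ) :
    ∃ a : VecSpace hlam hmu, ∀ l ≤ m, ∀ n,
      inner ℂ (taylorVec hlam hmu n l) a = if n + l = d then v l else 0 := by
  obtain ⟨c, hc⟩ := mulVec_taylorCoef_surjective hlam hmu (fun l => d - l) fun l => v l
  refine ⟨∑ j : Fin (m + 1), if j ≤ d then c j • basisVec hlam hmu j (d - j) else 0,
    fun l hl n => ?_⟩
  have hterm : ∀ j : Fin (m + 1), j ≤ d → inner ℂ (taylorVec hlam hmu n l)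
      (basisVec hlam hmu j (d - j)) =
        if n + l = d then ((mu j * taylorCoef lam n l j : ℝ) : ℂ) else 0 := by
    intro j hj
    rw [← inner_conj_symm, inner_basisVec_taylorVec, apply_ite (starRingEnd ℂ), Complex.conj_ofReal,
      map_zero]
    rcases lt_or_ge l j with hlj | hlj
    · simp [taylorCoef_of_lt lam n hlj]
    · exact if_congr (by omega) rfl rfl
  simp only [inner_sum, apply_ite (inner ℂ (taylorVec hlam hmu n l)), inner_zero_right]
  split_ifs with hd
  · obtain rfl : n = d - l := by omega
    rw [← congrFun hc ⟨l, by omega⟩, Matrix.mulVec, dotProduct]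
    refine Finset.sum_congr rfl fun j _ => ?_
    rw [Matrix.of_apply]
    split_ifs with hj
    · rw [inner_smul_right, hterm j hj, if_pos hd, mul_comm]
    · simp [taylorCoef_of_lt lam (d - l) (show l < j by omega)]
  · refine Finset.sum_eq_zero fun j _ => ?_
    split_ifs with hj
    · rw [inner_smul_right, hterm j hj, if_neg hd, mul_zero]
    · rfl

lemma exists_mem_graph_mulOp {d : ℕ} {b : VecSpace hlam hmu}
    (hb : ∀ n l, n + l ≠ d → inner ℂ (taylorVec hlam hmu n l) b = 0)
    (hb0 : ∀ l ≤ m, inner ℂ (taylorVec hlam hmu 0 l) b = 0) :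
    ∃ a, (a, b) ∈ (mulOp hlam hmu).graph := by
  obtain ⟨a, ha⟩ := exists_inner_taylorVec_eq hlam hmu (d - 1)
    fun l => inner ℂ (taylorVec hlam hmu (d - l) l) b
  refine ⟨a, (mem_graph_mulOp_iff hlam hmu).2 fun l hl => ⟨hb0 l hl, fun n => ?_⟩⟩
  rw [ha l hl]
  split_ifs with hn
  · rcases d.eq_zero_or_pos with rfl | hd
    · rw [hb (n + 1) l (by omega), Nat.zero_sub, hb0 l hl]
    · rw [show n + 1 = d - l by omega]
  · exact hb (n + 1) l (by omega)

lemma taylorVec_zero_mem_wanderingSubspace {l : ℕ} (hl : l ≤ m) :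
    taylorVec hlam hmu 0 l ∈ wanderingSubspace (mulOp hlam hmu) :=
  mem_wanderingSubspace.2 fun _ _ hab => ((mem_graph_mulOp_iff hlam hmu).1 hab l hl).1

lemma inner_taylorVec_basisVec_of_ne {n l d : ℕ} {j : Fin (m + 1)} (h : n + l ≠ d + j) :
    inner ℂ (taylorVec hlam hmu n l) (basisVec hlam hmu j d) = 0 := by
  rw [← inner_conj_symm, inner_basisVec_taylorVec]
  rcases lt_or_ge l j with hlj | hlj
  · simp [taylorCoef_of_lt lam n hlj]
  · rw [if_neg (by omega), map_zero]

lemma eq_zero_of_mem_wanderingSubspace {y : VecSpace hlam hmu}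
    (hy : y ∈ wanderingSubspace (mulOp hlam hmu))
    (hy0 : ∀ l ≤ m, inner ℂ (taylorVec hlam hmu 0 l) y = 0) : y = 0 := by
  refine eq_zero_of_inner_basisVec hlam hmu fun j d => ?_
  set w := taylorVec hlam hmu 0 (d + j)
  set e := basisVec hlam hmu j d
  -- Up to a multiple of `w`, the vector `e` lies in the range of `M^{(λ, μ)}`.
  obtain ⟨α, hα, hαy⟩ : ∃ α : ℂ, (d + j ≤ m → inner ℂ w (e - α • w) = 0) ∧
      inner ℂ (α • w) y = 0 := by
    rcases le_or_gt (d + j) m with hd | hd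
    · have hw : (inner ℂ w w : ℂ) ≠ 0 := by
        rw [inner_taylorVec_zero_self]
        exact Complex.ofReal_ne_zero.2 (componentNormSq_pos hlam (hmu 0).ne' _).ne'
      refine ⟨inner ℂ w e / inner ℂ w w, fun _ => ?_, ?_⟩
      · rw [inner_sub_right, inner_smul_right, div_mul_cancel₀ _ hw, sub_self]
      · rw [inner_smul_left, hy0 _ hd, mul_zero]
    · exact ⟨0, fun h => absurd h hd.not_ge, by simp⟩
  have hdegree : ∀ n l, n + l ≠ d + j → inner ℂ (taylorVec hlam hmu n l) (e - α • w) = 0 := by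
    intro n l hnl
    rw [inner_sub_right, inner_smul_right, inner_taylorVec_basisVec_of_ne hlam hmu hnl,
      inner_taylorVec_taylorVec_of_ne hlam hmu (by omega), mul_zero, sub_zero]
  obtain ⟨a, ha⟩ := exists_mem_graph_mulOp hlam hmu hdegree fun l hl => by
    rcases eq_or_ne l (d + j) with rfl | hne
    · exact hα hl
    · exact hdegree 0 l (by omega)
  have hey : inner ℂ y (e - α • w) = 0 := mem_wanderingSubspace.1 hy a _ ha
  rwa [inner_eq_zero_symm, inner_sub_left, hαy, sub_zero] at hey

theorem wanderingSubspace_mulOp : wanderingSubspace (mulOp hlam hmu) =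
    Submodule.span ℂ (Set.range fun l : Fin (m + 1) => taylorVec hlam hmu 0 l) := by
  set W := Submodule.span ℂ (Set.range fun l : Fin (m + 1) => taylorVec hlam hmu 0 l)
  have : FiniteDimensional ℂ W := FiniteDimensional.span_of_finite ℂ (Set.finite_range _)
  have hle : W ≤ wanderingSubspace (mulOp hlam hmu) := by
    rw [Submodule.span_le]
    rintro _ ⟨l, rfl⟩
    exact taylorVec_zero_mem_wanderingSubspace hlam hmu l.is_le
  have hbot : Wᗮ ⊓ wanderingSubspace (mulOp hlam hmu) = ⊥ := by
    refine (Submodule.eq_bot_iff _).2 fun y hy => ?_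
    refine eq_zero_of_mem_wanderingSubspace hlam hmu hy.2 fun l hl => hy.1 _ ?_
    exact Submodule.subset_span ⟨⟨l, Nat.lt_succ_of_le hl⟩, rfl⟩
  rw [← Submodule.sup_orthogonal_inf_of_hasOrthogonalProjection hle, hbot, sup_bot_eq]

end WanderingSubspace

section CauchyDualFrame

variable {m : ℕ}

/-- The inverse of `componentNormSq`, set to zero in the range `r > m` where there is no component
of index `r`. -/
def componentNormSqInv (lam : ℝ) (mu : Fin (m + 1) → ℝ) (r : ℕ) : ℝ :=
  if r ≤ m then (componentNormSq lam mu r)⁻¹ else 0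

/-- The numbers `r² b_{r-1} / b_r` for `r ≤ m`, and `0` for `r > m`, where `b` stands for
`componentNormSq`. -/
def normSqRatio (lam : ℝ) (mu : Fin (m + 1) → ℝ) (r : ℕ) : ℝ :=
  r ^ 2 * componentNormSq lam mu (r - 1) * componentNormSqInv lam mu r

/-- The sequence whose iterated differences are, up to nonzero factors, the inner products of the
Cauchy dual vectors. -/
def potential (lam : ℝ) (mu : Fin (m + 1) → ℝ) (r : ℕ) : ℝ :=
  r ^ 2 + (2 * lam - m - 1) * r - normSqRatio lam mu r

variable {lam : ℝ} {mu : Fin (m + 1) → ℝ}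

lemma componentNormSqInv_of_lt {r : ℕ} (h : m < r) : componentNormSqInv lam mu r = 0 :=
  if_neg h.not_ge

lemma componentNormSq_mul_inv (hlam : (m : ℝ) / 2 < lam) (hmu : mu 0 ≠ 0) {r : ℕ} (h : r ≤ m) :
    componentNormSq lam mu r * componentNormSqInv lam mu r = 1 := by
  rw [componentNormSqInv, if_pos h, mul_inv_cancel₀ (componentNormSq_pos hlam hmu r).ne']

lemma normSqRatio_nonneg (hlam : (m : ℝ) / 2 < lam) (hmu : mu 0 ≠ 0) (r : ℕ) :
    0 ≤ normSqRatio lam mu r := by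
  have hb := fun r => (componentNormSq_pos hlam hmu r).le
  refine mul_nonneg (mul_nonneg (sq_nonneg _) (hb _)) ?_
  unfold componentNormSqInv
  split_ifs
  · exact inv_nonneg.2 (hb r)
  · exact le_rfl

lemma componentNormSqInv_mul_eq_sub_potential (hlam : (m : ℝ) / 2 < lam) (hmu : mu 0 ≠ 0)
    {n r l : ℕ} (h : n + r = l + 1) (hl : l ≤ m) :
    componentNormSqInv lam mu r * (n * (2 * lam - m + r + l) * componentNormSq lam mu r +
      r ^ 2 * componentNormSq lam mu (r - 1)) =
        (l + 1) * (2 * lam - m + l) - potential lam mu r := by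
  have hn : (n : ℝ) = l + 1 - r := by rw [eq_sub_iff_add_eq]; exact_mod_cast h
  have hinv : n * (componentNormSq lam mu r * componentNormSqInv lam mu r) = n := by
    rcases n.eq_zero_or_pos with rfl | hpos
    · rw [Nat.cast_zero, zero_mul]
    · rw [componentNormSq_mul_inv hlam hmu (by omega), mul_one]
  rw [potential, normSqRatio]
  linear_combination (2 * lam - m + r + l) * hinv + (2 * lam - m + r + l) * hn

lemma potential_zero : potential lam mu 0 = 0 := by simp [potential, normSqRatio]

lemma potential_succ_self :
    potential lam mu (m + 1) = (m + 1) ^ 2 + (2 * lam - m - 1) * (m + 1) := by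
  simp [potential, normSqRatio, componentNormSqInv_of_lt (Nat.lt_succ_self m)]

lemma fwdDiff_potential_zero_lt (hlam : (m : ℝ) / 2 < lam) (hmu : mu 0 ≠ 0) (hm : 1 ≤ m) :
    fwdDiff 1 (potential lam mu) 0 < fwdDiff 1 (potential lam mu) m := by
  have hone : potential lam mu 1 = 2 * lam - m - normSqRatio lam mu 1 := by
    rw [potential]
    push_cast
    ring
  have hρ := normSqRatio_nonneg hlam hmu
  have hm0 : (0 : ℝ) < m := by exact_mod_cast hm
  rw [fwdDiff, fwdDiff, zero_add, potential_zero, potential_succ_self, hone, potential]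
  linarith [hρ 1, hρ m]

variable (hlam : (m : ℝ) / 2 < lam) (hmu : ∀ j, 0 < mu j)

/-- The iterates of the vectors `b_p⁻¹ t_{0,p}`, `p ≤ m`, under the Cauchy dual of `M^{(λ, μ)}`,
in closed form, where `t` stands for `taylorVec` and `b` for `componentNormSq`. -/
def dualVec (n p : ℕ) : VecSpace hlam hmu :=
  ∑ q ∈ Finset.range (n + 1),
    (((-1) ^ q * (p + q).choose p * componentNormSqInv lam mu (p + q) : ℝ) : ℂ) •
      taylorVec hlam hmu (n - q) (p + q)

lemma inner_dualVec_left (n p : ℕ) (f : VecSpace hlam hmu) :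
    inner ℂ (dualVec hlam hmu n p) f = ∑ q ∈ Finset.range (n + 1),
      (((-1) ^ q * (p + q).choose p * componentNormSqInv lam mu (p + q) : ℝ) : ℂ) *
        inner ℂ (taylorVec hlam hmu (n - q) (p + q)) f := by
  simp only [dualVec, sum_inner, inner_smul_left, Complex.conj_ofReal]

lemma inner_dualVec_taylorVec_of_ne {n p n' l : ℕ} (h : n + p ≠ n' + l) :
    inner ℂ (dualVec hlam hmu n p) (taylorVec hlam hmu n' l) = 0 := by
  rw [inner_dualVec_left]
  refine Finset.sum_eq_zero fun q hq => ?_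
  have hq' := Finset.mem_range.1 hq
  rw [inner_taylorVec_taylorVec_of_ne hlam hmu (by omega), mul_zero]

lemma inner_dualVec_succ_taylorVec_zero (n p : ℕ) {l : ℕ} (hl : l ≤ m) :
    inner ℂ (dualVec hlam hmu (n + 1) p) (taylorVec hlam hmu 0 l) = 0 := by
  by_cases hdegree : n + 1 + p = 0 + l
  swap
  · exact inner_dualVec_taylorVec_of_ne hlam hmu hdegree
  have hterm : ∀ q ∈ Finset.range (n + 1 + 1),
      (((-1) ^ q * (p + q).choose p * componentNormSqInv lam mu (p + q) : ℝ) : ℂ) *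
        inner ℂ (taylorVec hlam hmu (n + 1 - q) (p + q)) (taylorVec hlam hmu 0 l) =
      ((l.choose p * ((-1) ^ q * (n + 1).choose q) : ℝ) : ℂ) := by
    intro q hq
    have hq' := Finset.mem_range.1 hq
    have hchoose : (l.choose (p + q) : ℝ) * (p + q).choose p = l.choose p * (n + 1).choose q := by
      have h := Nat.choose_mul (n := l) (Nat.le_add_right p q)
      rw [show l - p = n + 1 by omega, Nat.add_sub_cancel_left] at h
      exact_mod_cast h
    have hinner := inner_taylorVec_taylorVec_zero hlam hmu (p + q) (n + 1 - q)
    rw [show n + 1 - q + (p + q) = l by omega] at hinner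
    rw [hinner, ← Complex.ofReal_mul]
    congr 1
    linear_combination (-1) ^ q * (p + q).choose p * (l.choose (p + q) : ℝ) *
      componentNormSq_mul_inv hlam (hmu 0).ne' (show p + q ≤ m by omega) + (-1) ^ q * hchoose
  have halternating : ∑ q ∈ Finset.range (n + 1 + 1), (-1 : ℝ) ^ q * (n + 1).choose q = 0 := by
    exact_mod_cast Int.alternating_sum_range_choose_of_ne n.succ_ne_zero
  rw [inner_dualVec_left, Finset.sum_congr rfl hterm, ← Complex.ofReal_sum, ← Finset.mul_sum,
    halternating, mul_zero, Complex.ofReal_zero]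

lemma isCauchyDual_dualVec (n p : ℕ) :
    IsCauchyDual (mulOp hlam hmu) (dualVec hlam hmu n p) (dualVec hlam hmu (n + 1) p) where
  inner_eq a b hab := by
    rw [mem_graph_mulOp_iff] at hab
    have hzero : ∀ l,
        (componentNormSqInv lam mu l : ℂ) * inner ℂ (taylorVec hlam hmu 0 l) b = 0 := by
      intro l
      rcases le_or_gt l m with hl | hl
      · rw [(hab l hl).1, mul_zero]
      · rw [componentNormSqInv_of_lt hl, Complex.ofReal_zero, zero_mul]
    have hsucc : ∀ n l, (componentNormSqInv lam mu l : ℂ) *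
        inner ℂ (taylorVec hlam hmu (n + 1) l) b =
          componentNormSqInv lam mu l * inner ℂ (taylorVec hlam hmu n l) a := by
      intro n l
      rcases le_or_gt l m with hl | hl
      · rw [(hab l hl).2]
      · rw [componentNormSqInv_of_lt hl, Complex.ofReal_zero, zero_mul, zero_mul]
    simp only [inner_dualVec_left, Complex.ofReal_mul, mul_assoc]
    rw [Finset.sum_range_succ, Nat.sub_self, hzero, mul_zero, mul_zero, add_zero]
    refine Finset.sum_congr rfl fun q hq => ?_
    rw [Nat.succ_sub (Finset.mem_range_succ_iff.1 hq), hsucc]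
  mem_orthogonal := by
    rw [wanderingSubspace_mulOp, Submodule.mem_orthogonal']
    intro u hu
    induction hu using Submodule.span_induction with
    | mem u hu =>
      obtain ⟨l, rfl⟩ := hu
      exact inner_dualVec_succ_taylorVec_zero hlam hmu n p l.is_le
    | zero => exact inner_zero_right _
    | add u v _ _ hu hv => rw [inner_add_right, hu, hv, add_zero]
    | smul c u _ hu => rw [inner_smul_right, hu, mul_zero]

lemma dualVec_zero {p : ℕ} (hp : p ≤ m) : dualVec hlam hmu 0 p =
    (((componentNormSq lam mu p)⁻¹ : ℝ) : ℂ) • taylorVec hlam hmu 0 p := by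
  rw [dualVec, Finset.sum_range_one, add_zero, Nat.choose_self, componentNormSqInv, if_pos hp]
  norm_num

lemma dualVec_one (p : ℕ) : dualVec hlam hmu 1 p =
    (componentNormSqInv lam mu p : ℂ) • taylorVec hlam hmu 1 p -
      (((p + 1) * componentNormSqInv lam mu (p + 1) : ℝ) : ℂ) • taylorVec hlam hmu 0 (p + 1) := by
  rw [dualVec, Finset.sum_range_succ, Finset.sum_range_one, sub_eq_add_neg, ← neg_smul]
  congr 2
  · norm_num
  · push_cast [Nat.choose_succ_self_right]
    ring

lemma inner_dualVec_succ_dualVec_one (n p l : ℕ) :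
    inner ℂ (dualVec hlam hmu (n + 1) p) (dualVec hlam hmu 1 l) =
      componentNormSqInv lam mu l *
        inner ℂ (dualVec hlam hmu (n + 1) p) (taylorVec hlam hmu 1 l) := by
  rw [dualVec_one, inner_sub_right, inner_smul_right, inner_smul_right, sub_eq_self]
  rcases lt_or_ge l m with hl | hl
  · rw [inner_dualVec_succ_taylorVec_zero hlam hmu n p hl, mul_zero]
  · rw [componentNormSqInv_of_lt (Nat.lt_succ_of_le hl), mul_zero, Complex.ofReal_zero, zero_mul]

lemma inner_dualVec_taylorVec_one {p k : ℕ} (h : p + k ≤ m) :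
    inner ℂ (dualVec hlam hmu (k + 1) p) (taylorVec hlam hmu 1 (p + k)) =
      (((p + k).factorial / (p.factorial * (k + 1).factorial) *
        ((-1) ^ k * (fwdDiff 1)^[k + 1] (potential lam mu) p) : ℝ) : ℂ) := by
  set κ : ℝ := ((p + k : ℕ) + 1) * (2 * lam - m + (p + k : ℕ))
  have hterm : ∀ q ∈ Finset.range (k + 1 + 1),
      (((-1) ^ q * (p + q).choose p * componentNormSqInv lam mu (p + q) : ℝ) : ℂ) *
        inner ℂ (taylorVec hlam hmu (k + 1 - q) (p + q)) (taylorVec hlam hmu 1 (p + k)) =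
      ((-((p + k).factorial / (p.factorial * (k + 1).factorial)) *
        ((-1) ^ q * (k + 1).choose q * (potential lam mu (p + q) - κ)) : ℝ) : ℂ) := by
    intro q hq
    have hqk : q ≤ k + 1 := Finset.mem_range_succ_iff.1 hq
    have hdegree : k + 1 - q + (p + q) = p + k + 1 := by omega
    have hbracket :=
      componentNormSqInv_mul_eq_sub_potential (mu := mu) hlam (hmu 0).ne' hdegree h
    rw [inner_taylorVec_taylorVec_one hlam hmu hdegree, ← Complex.ofReal_mul,
      ← neg_sub κ, ← hbracket, Nat.cast_add_choose, Nat.cast_choose ℝ hqk]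
    congr 1
    field_simp
  rw [inner_dualVec_left, Finset.sum_congr rfl hterm, ← Complex.ofReal_sum, ← Finset.mul_sum,
    sum_neg_one_pow_mul_choose (fun r => potential lam mu r - κ),
    fwdDiff_iter_sub_const _ _ _ k.succ_ne_zero, pow_succ]
  congr 1
  ring

/-- The Cauchy dual vectors, normalized so that those of index `n = 0` form an orthonormal basis of
the wandering subspace. -/
def normalizedDualVec (n : ℕ) (p : Fin (m + 1)) : VecSpace hlam hmu :=
  (√(componentNormSq lam mu p) : ℂ) • dualVec hlam hmu n p

lemma normalizedDualVec_zero (p : Fin (m + 1)) : normalizedDualVec hlam hmu 0 p =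
    (((√(componentNormSq lam mu p))⁻¹ : ℝ) : ℂ) • taylorVec hlam hmu 0 p := by
  rw [normalizedDualVec, dualVec_zero hlam hmu p.is_le, smul_smul, ← Complex.ofReal_mul,
    ← div_eq_mul_inv, Real.sqrt_div_self]

lemma isCauchyDualFrame_normalizedDualVec :
    IsCauchyDualFrame (mulOp hlam hmu) (normalizedDualVec hlam hmu) where
  orthonormal := by
    rw [orthonormal_iff_ite]
    intro p q
    rw [normalizedDualVec_zero, normalizedDualVec_zero, inner_smul_left, inner_smul_right,
      Complex.conj_ofReal]
    split_ifs with hpq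
    · have hb := componentNormSq_pos hlam (hmu 0).ne' p
      rw [← hpq, inner_taylorVec_zero_self, ← Complex.ofReal_mul, ← Complex.ofReal_mul,
        Complex.ofReal_eq_one]
      field_simp
      rw [Real.sq_sqrt hb.le]
    · rw [inner_taylorVec_taylorVec_of_ne hlam hmu (by omega), mul_zero, mul_zero]
  span_eq := by
    rw [wanderingSubspace_mulOp]
    refine le_antisymm (Submodule.span_le.2 ?_) (Submodule.span_le.2 ?_) <;> rintro _ ⟨p, rfl⟩
    · rw [normalizedDualVec_zero]
      exact Submodule.smul_mem _ _ (Submodule.subset_span ⟨p, rfl⟩)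
    · have hb := Real.sqrt_pos.2 (componentNormSq_pos hlam (hmu 0).ne' p)
      have hmem : (√(componentNormSq lam mu p) : ℂ) • normalizedDualVec hlam hmu 0 p ∈
          Submodule.span ℂ (Set.range (normalizedDualVec hlam hmu 0)) :=
        Submodule.smul_mem _ _ (Submodule.subset_span ⟨p, rfl⟩)
      rwa [normalizedDualVec_zero, smul_smul, ← Complex.ofReal_mul, mul_inv_cancel₀ hb.ne',
        Complex.ofReal_one, one_smul] at hmem
  isCauchyDual n p := (isCauchyDual_dualVec hlam hmu n p).smul _

lemma isSuperdiagonal_crossGram (k : ℕ) : IsSuperdiagonal k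
    (crossGram (normalizedDualVec hlam hmu (k + 1)) (normalizedDualVec hlam hmu 1)) := by
  intro p l hpl
  rw [crossGram, Matrix.of_apply, normalizedDualVec, normalizedDualVec, inner_smul_left,
    inner_smul_right, inner_dualVec_succ_dualVec_one,
    inner_dualVec_taylorVec_of_ne hlam hmu (by omega), mul_zero, mul_zero, mul_zero]

lemma crossGram_apply (p k : ℕ) (h : p + k ≤ m) :
    crossGram (normalizedDualVec hlam hmu (k + 1)) (normalizedDualVec hlam hmu 1) ⟨p, by omega⟩
      ⟨p + k, by omega⟩ = ((√(componentNormSq lam mu p) / √(componentNormSq lam mu (p + k)) *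
        ((p + k).factorial / (p.factorial * (k + 1).factorial) *
        ((-1) ^ k * (fwdDiff 1)^[k + 1] (potential lam mu) p)) : ℝ) : ℂ) := by
  rw [crossGram, Matrix.of_apply, normalizedDualVec, normalizedDualVec, inner_smul_left,
    inner_smul_right, inner_dualVec_succ_dualVec_one, inner_dualVec_taylorVec_one hlam hmu h,
    componentNormSqInv, if_pos h, Complex.conj_ofReal]
  have hsqrt : √(componentNormSq lam mu (p + k)) * (componentNormSq lam mu (p + k))⁻¹ =
      (√(componentNormSq lam mu (p + k)))⁻¹ := by
    rw [← div_eq_mul_inv, Real.sqrt_div_self]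
  simp only [← Complex.ofReal_mul]
  congr 1
  rw [div_eq_mul_inv √_, ← hsqrt]
  ring

lemma crossGram_apply_self (p : Fin (m + 1)) :
    crossGram (normalizedDualVec hlam hmu 1) (normalizedDualVec hlam hmu 1) p p =
      ((fwdDiff 1 (potential lam mu) p : ℝ) : ℂ) := by
  have hb := Real.sqrt_pos.2 (componentNormSq_pos hlam (hmu 0).ne' p)
  have hp : (p.val.factorial : ℝ) ≠ 0 := by positivity
  refine (crossGram_apply hlam hmu p 0 p.is_le).trans ?_
  simp [hb.ne', hp]

lemma isConnectedFamily_crossGram (hm : 1 ≤ m) : IsConnectedFamily fun k =>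
    crossGram (normalizedDualVec hlam hmu (k + 1)) (normalizedDualVec hlam hmu 1) := by
  intro c hc i j
  set X : ℕ → ℂ := fun p => c (Fin.ofNat (m + 1) p)
  have hXval : ∀ i, X (i : Fin (m + 1)) = c i := fun i => congrArg c (Fin.ofNat_val_eq_self i)
  have hedge : ∀ p k, p + k ≤ m → (fwdDiff 1)^[k] (fwdDiff 1 (potential lam mu)) p ≠ 0 →
      X p = X (p + k) := by
    intro p k hpk hne
    have hb := fun r => Real.sqrt_pos.2 (componentNormSq_pos hlam (hmu 0).ne' r)
    have hentry := hc k ⟨p, by omega⟩ ⟨p + k, by omega⟩ <| by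
      refine (crossGram_apply hlam hmu p k hpk).trans_ne ?_
      rw [Function.iterate_succ_apply]
      refine Complex.ofReal_ne_zero.2 (mul_ne_zero (div_pos (hb _) (hb _)).ne' ?_)
      exact mul_ne_zero (by positivity) (mul_ne_zero (by positivity) hne)
    rwa [← hXval, ← hXval] at hentry
  have hends := (fwdDiff_potential_zero_lt hlam (hmu 0).ne' hm).ne
  rw [← hXval, ← hXval, eq_of_fwdDiff_iter_ne_zero hedge hends i.is_le,
    eq_of_fwdDiff_iter_ne_zero hedge hends j.is_le]

theorem fwdDiff_potential_eq {lam' : ℝ} {mu' : Fin (m + 1) → ℝ} {hlam : (m : ℝ) / 2 < lam}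
    {hlam' : (m : ℝ) / 2 < lam'} {hmu : ∀ j, 0 < mu j} {hmu' : ∀ j, 0 < mu' j}
    (h : UnitarilyEquivalent (mulOp hlam hmu) (mulOp hlam' hmu')) (hm : 1 ≤ m) {p : ℕ}
    (hp : p ≤ m) : fwdDiff 1 (potential lam mu) p = fwdDiff 1 (potential lam' mu') p := by
  obtain ⟨V, hV, hgram⟩ := h.exists_crossGram_eq (isCauchyDualFrame_normalizedDualVec hlam hmu)
    (isCauchyDualFrame_normalizedDualVec hlam' hmu')
  have hV0 : IsSuperdiagonal 0 V :=
    (isConnectedFamily_crossGram hlam hmu hm).isSuperdiagonal_zero_of_intertwines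
      (isSuperdiagonal_crossGram hlam hmu) (isSuperdiagonal_crossGram hlam' hmu') hV
      fun k => hgram (k + 1) 1
  have hentry := apply_self_eq_of_intertwines hV0 hV (hgram 1 1) ⟨p, by omega⟩
  rw [crossGram_apply_self, crossGram_apply_self] at hentry
  exact_mod_cast hentry

end CauchyDualFrame

section Parameters

variable {m : ℕ} {lam lam' : ℝ} {mu mu' : Fin (m + 1) → ℝ}

lemma potential_eq_of_fwdDiff_eq
    (h : ∀ p ≤ m, fwdDiff 1 (potential lam mu) p = fwdDiff 1 (potential lam' mu') p) {r : ℕ}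
    (hr : r ≤ m + 1) : potential lam mu r = potential lam' mu' r := by
  induction r with
  | zero => rw [potential_zero, potential_zero]
  | succ r ih =>
    have hstep := h r (by omega)
    rwa [fwdDiff, fwdDiff, ih (by omega), sub_left_inj] at hstep

lemma eq_of_potential_succ_self_eq
    (h : potential lam mu (m + 1) = potential lam' mu' (m + 1)) : lam = lam' := by
  have hm : 2 * (m + 1 : ℝ) ≠ 0 := by positivity
  rw [potential_succ_self, potential_succ_self] at h
  refine mul_left_cancel₀ hm ?_
  linear_combination h

lemma componentNormSq_zero : componentNormSq lam mu 0 = mu 0 ^ 2 := by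
  rw [componentNormSq, Finset.sum_eq_single 0]
  · rw [Fin.val_zero, componentWeight_self, mul_one]
  · intro j _ hj
    rw [componentWeight_of_lt _ (show ((0 : ℕ) < j) from Fin.pos_iff_ne_zero.2 hj), mul_zero]
  · exact fun h => (h (Finset.mem_univ 0)).elim

lemma componentNormSq_eq_of_potential_eq (hlam : (m : ℝ) / 2 < lam) (hmu' : mu' 0 ≠ 0)
    (hzero : mu 0 ^ 2 = mu' 0 ^ 2)
    (h : ∀ r ≤ m, potential lam mu r = potential lam mu' r) {r : ℕ} (hr : r ≤ m) :
    componentNormSq lam mu r = componentNormSq lam mu' r := by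
  induction r with
  | zero => rw [componentNormSq_zero, componentNormSq_zero, hzero]
  | succ r ih =>
    have hratio : normSqRatio lam mu (r + 1) = normSqRatio lam mu' (r + 1) := by
      have h' := h (r + 1) hr
      rwa [potential, potential, sub_right_inj] at h'
    have hfactor : ((r + 1 : ℕ) : ℝ) ^ 2 * componentNormSq lam mu' r ≠ 0 :=
      mul_ne_zero (by positivity) (componentNormSq_pos hlam hmu' r).ne'
    rw [normSqRatio, normSqRatio, Nat.add_sub_cancel, ih (by omega)] at hratio
    have hinv := mul_left_cancel₀ hfactor hratio
    rwa [componentNormSqInv, componentNormSqInv, if_pos hr, if_pos hr, inv_inj] at hinv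

lemma eq_of_componentNormSq_eq (hmu : ∀ j, 0 ≤ mu j) (hmu' : ∀ j, 0 ≤ mu' j)
    (h : ∀ r ≤ m, componentNormSq lam mu r = componentNormSq lam mu' r) : mu = mu' := by
  funext j
  induction j using WellFoundedLT.induction with
  | ind j ih =>
    have hj := h j j.is_le
    have hrest : ∀ i ∈ Finset.univ.erase j, mu i ^ 2 * componentWeight (lamIdx lam i) i j =
        mu' i ^ 2 * componentWeight (lamIdx lam i) i j := by
      intro i hi
      rcases (Finset.ne_of_mem_erase hi).lt_or_gt with hij | hij
      · rw [ih i hij]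
      · rw [componentWeight_of_lt _ hij, mul_zero, mul_zero]
    rw [componentNormSq, componentNormSq, ← Finset.add_sum_erase _ _ (Finset.mem_univ j),
      ← Finset.add_sum_erase _ _ (Finset.mem_univ j), Finset.sum_congr rfl hrest, add_left_inj,
      componentWeight_self, mul_one, mul_one] at hj
    exact (sq_eq_sq₀ (hmu j) (hmu' j)).1 hj

end Parameters

end HomogeneousShift

end

theorem mainTheorem2 (m : ℕ) (hm : 1 ≤ m)
    (lam lam' : ℝ) (hlam : (m : ℝ) / 2 < lam) (hlam' : (m : ℝ) / 2 < lam')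
    (mu mu' : Fin (m + 1) → ℝ) (hmu : ∀ j, 0 < mu j) (hmu' : ∀ j, 0 < mu' j)
    (hmu0 : mu 0 = 1) (hmu0' : mu' 0 = 1)
    (h : HomogeneousShift.UnitarilyEquivalent
      (HomogeneousShift.mulOp hlam hmu) (HomogeneousShift.mulOp hlam' hmu')) :
    lam = lam' ∧ mu = mu' := by
  have hpotential : ∀ r ≤ m + 1,
      HomogeneousShift.potential lam mu r = HomogeneousShift.potential lam' mu' r := fun r =>
    HomogeneousShift.potential_eq_of_fwdDiff_eq fun p hp =>
      HomogeneousShift.fwdDiff_potential_eq h hm hp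
  obtain rfl := HomogeneousShift.eq_of_potential_succ_self_eq (hpotential (m + 1) le_rfl)
  have hnormSq : ∀ r ≤ m, HomogeneousShift.componentNormSq lam mu r =
      HomogeneousShift.componentNormSq lam mu' r := fun r =>
    HomogeneousShift.componentNormSq_eq_of_potential_eq hlam (hmu' 0).ne'
      (by rw [hmu0, hmu0']) fun r hr => hpotential r (Nat.le_succ_of_le hr)
  exact ⟨rfl, HomogeneousShift.eq_of_componentNormSq_eq (fun j => (hmu j).le)
    (fun j => (hmu' j).le) hnormSq⟩
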